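/- Let $(\Omega,\mathcal F,\mathbb P)$ be a probability space and let $L_0$ be the space of real random variables modulo a.s. equality, with the a.s. pointwise order. Let $\Phi:\mathbb R\to\mathbb R$ be a Young function, i.e. an even convex function with $\Phi(0)=0$ and $\lim_{x\to+\infty}\Phi(x)/x=+\infty$, and assume $\Phi\in\Delta_2$, i.e. $\limsup_{x\to\infty}\Phi(2x)/\Phi(x)<\infty$. Let $\Phi^*(y)=\sup_{x\in\mathbb R}(xy-\Phi(x))$ be its conjugate, let $\mathbb B_{\Phi^*}=\{\xi\in L_0:\mathbb E[\Phi^*(\xi)]\le 1\}$, and let $L_{\Phi^*}=\bigcup_{\lambda>0}\lambda\mathbb B_{\Phi^*}$ be the Orlicz space of $\Phi^*$, with the norm $\|\xi\|_{\Phi^*}=\inf\{\lambda>0:\xi\in\lambda\mathbb B_{\Phi^*}\}$. Then every norm bounded sequence $(\xi_n)_n$ in $L_{\Phi^*}$ admits a subsequence $(\xi_{n_k})_k$ and a $\xi\in L_{\Phi^*}$ such that for every further subsequence $(\xi_{n_{k(i)}})_i$ there is a strictly increasing sequence $(N_l)_l$ of positive integers with $$\sup_l\left|\frac1{N_l}\sum_{i\le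 N_l}\xi_{n_{k(i)}}\right|\in L_{\Phi^*}\qquad\text{and}\qquad \frac1{N_l}\sum_{i\le N_l}\xi_{n_{k(i)}}\longrightarrow\xi\ \text{ a.s. as } l\to\infty .$$ -/

import Mathlib

open MeasureTheory Filter Topology

/-- A (finite coercive) Young function: an even convex function `Φ : ℝ → ℝ` with `Φ 0 = 0` and
`Φ x / x → +∞` as `x → +∞`. -/
structure IsYoungFunction (Φ : ℝ → ℝ) : Prop where
  convexOn : ConvexOn ℝ Set.univ Φ
  even : ∀ x, Φ (-x) = Φ x
  map_zero : Φ 0 = 0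
  coercive : Tendsto (fun x => Φ x / x) atTop atTop

/-- The `Δ₂`-condition `limsup_{x → ∞} Φ (2 x) / Φ x < ∞`, the limsup being taken in `[-∞, ∞]`. -/
def SatisfiesDeltaTwo (Φ : ℝ → ℝ) : Prop :=
  limsup (fun x : ℝ => ((Φ (2 * x) / Φ x : ℝ) : EReal)) atTop < ⊤

/-- The conjugate `Φ* y = sup_x (x y - Φ x)`. For a Young function the supremum is finite, see
`IsYoungFunction.bddAbove_conjugate`. -/
noncomputable def youngConjugate (Φ : ℝ → ℝ) (y : ℝ) : ℝ :=
  ⨆ x : ℝ, (x * y - Φ x)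

theorem IsYoungFunction.nonneg {Φ : ℝ → ℝ} (h : IsYoungFunction Φ) (x : ℝ) : 0 ≤ Φ x := by
  have h1 := h.convexOn.2 (Set.mem_univ x) (Set.mem_univ (-x))
    (by norm_num : (0 : ℝ) ≤ 1 / 2) (by norm_num : (0 : ℝ) ≤ 1 / 2) (by norm_num)
  simp only [smul_eq_mul, h.even] at h1
  have h2 : (1 / 2 : ℝ) * x + 1 / 2 * -x = 0 := by ring
  rw [h2, h.map_zero] at h1
  linarith

theorem IsYoungFunction.bddAbove_conjugate {Φ : ℝ → ℝ} (h : IsYoungFunction Φ) (y : ℝ) :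
    BddAbove (Set.range fun x : ℝ => x * y - Φ x) := by
  obtain ⟨a, ha⟩ := eventually_atTop.1 (h.coercive.eventually_ge_atTop |y|)
  have hb : 0 < max a 1 := lt_max_of_lt_right one_pos
  refine ⟨max a 1 * |y|, ?_⟩
  rintro _ ⟨x, rfl⟩
  have hxy : x * y ≤ |x| * |y| := by rw [← abs_mul]; exact le_abs_self _
  have hΦ : Φ x = Φ |x| := by
    rcases abs_choice x with hx | hx <;> rw [hx]
    exact (h.even x).symm
  change x * y - Φ x ≤ _
  rcases le_total |x| (max a 1) with hx | hx
  · have := mul_le_mul_of_nonneg_right hx (abs_nonneg y)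
    linarith [h.nonneg x]
  · have h1 := ha |x| (le_trans (le_max_left _ _) hx)
    rw [le_div_iff₀ (lt_of_lt_of_le hb hx)] at h1
    have := mul_nonneg hb.le (abs_nonneg y)
    rw [hΦ]
    linarith

/-- The conjugate of a Young function is again a Young function. -/
theorem IsYoungFunction.conjugate {Φ : ℝ → ℝ} (h : IsYoungFunction Φ) :
    IsYoungFunction (youngConjugate Φ) where
  convexOn := by
    refine ⟨convex_univ, fun y _ z _ a b ha hb hab => ciSup_le fun x => ?_⟩
    have h1 := mul_le_mul_of_nonneg_left (le_ciSup (h.bddAbove_conjugate y) x) ha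
    have h2 := mul_le_mul_of_nonneg_left (le_ciSup (h.bddAbove_conjugate z) x) hb
    have h3 : Φ x = a * Φ x + b * Φ x := by rw [← add_mul, hab, one_mul]
    simp only [smul_eq_mul, youngConjugate]
    linarith
  even := fun y => by
    unfold youngConjugate
    rw [← (Equiv.neg ℝ).iSup_comp]
    simp [h.even]
  map_zero := by
    apply le_antisymm
    · exact ciSup_le fun x => by linarith [h.nonneg x]
    · have := le_ciSup (h.bddAbove_conjugate 0) 0
      simpa [youngConjugate, h.map_zero] using this
  coercive := by
    refine tendsto_atTop.2 fun M => ?_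
    filter_upwards [eventually_ge_atTop (max 1 (Φ (M + 1)))] with y hy
    have hy1 := (le_max_left _ _).trans hy
    have hy2 := (le_max_right _ _).trans hy
    rw [le_div_iff₀ (by linarith)]
    have := le_ciSup (h.bddAbove_conjugate y) (M + 1)
    change _ ≤ youngConjugate Φ y at this
    linarith

/-- The unit ball `{ξ ∈ L₀ : E[Φ(ξ)] ≤ 1}`, where `L₀ = (Ω →ₘ[P] ℝ)` is the space of a.s. equality
classes of real random variables. -/
def orliczUnitBall {Ω : Type*} [MeasurableSpace Ω] (Φ : ℝ → ℝ) (P : Measure Ω) : Set (Ω →ₘ[P] ℝ) :=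
  {ξ | ∫⁻ ω, ENNReal.ofReal (Φ (ξ ω)) ∂P ≤ 1}

/-- The Orlicz space, the union over `r > 0` of the dilations by `r` of the unit ball. -/
def orliczSpace {Ω : Type*} [MeasurableSpace Ω] (Φ : ℝ → ℝ) (P : Measure Ω) : Set (Ω →ₘ[P] ℝ) :=
  {ξ | ∃ r : ℝ, 0 < r ∧ r⁻¹ • ξ ∈ orliczUnitBall Φ P}

/-- The norm of the Orlicz space, i.e. the gauge of the unit ball. -/
noncomputable def orliczNorm {Ω : Type*} [MeasurableSpace Ω] (Φ : ℝ → ℝ) (P : Measure Ω) (ξ : Ω →ₘ[P] ℝ) : ℝ :=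
  sInf {r : ℝ | 0 < r ∧ r⁻¹ • ξ ∈ orliczUnitBall Φ P}

/-- The mean of the first `N` terms of a sequence in `L₀` (meaningful for `N ≥ 1`). -/
noncomputable def cesaroMean {Ω : Type*} [MeasurableSpace Ω] {P : Measure Ω} (ξ : ℕ → Ω →ₘ[P] ℝ) (N : ℕ) : Ω →ₘ[P] ℝ :=
  (N : ℝ)⁻¹ • ∑ i ∈ Finset.range N, ξ i

/-!
Write `Ψ = Φ*`. After division by a constant, `E[Ψ(Xₙ)] ≤ 1` for all `n`.

*Splitting.* The sequence `Ψ(Xₙ)` is bounded in `L¹`, so along a subsequence there are pairwise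
disjoint sets `Aₙ` such that the functions `Ψ(Xₙ) 1_{Aₙᶜ}` are equi-integrable
(`exists_subseq_splitting`). Put `Yₙ = Xₙ 1_{Aₙᶜ}` and `Zₙ = Xₙ 1_{Aₙ}`.

*The disjoint part.* The `Δ₂`-condition on `Φ` dualizes to `2 K Ψ(y) ≤ Ψ(K y)` for large `y`
(`SatisfiesDeltaTwo.conjugate_growth`). Iterated, this says `N Ψ(y / N) ≤ ε_N Ψ(y)` with `ε_N → 0`,
as long as `|y| ≥ b N`. At each point at most one `Zₙ` is nonzero, so the means of the `Zₙ` tend to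
`0` everywhere, and the part of `Ψ` above the level `Ψ(b)` has an integral along these means that
tends to `0` (`IsYoungFunction.tendsto_lintegral_posPartSub_avg_indicator`).

*The equi-integrable part.* By coercivity of `Ψ`, truncation at level `m` changes `Yₙ` by at most
`ε_m` in `L¹`, uniformly in `n`. The truncated sequences are bounded in `L²`, and a Banach-Saks
argument in Hilbert space (`exists_subseq_avg_cauchy`) gives one subsequence all of whose further
subsequences have means converging in `L¹` to one and the same `X₀`
(`IsYoungFunction.exists_subseq_avg_tendsto_eLpNorm`). By convexity and equi-integrability the part
of `Ψ` above `Ψ(b)` again has vanishing integral along the differences of these means and `X₀`.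

*Choice of `N_l`.* For any further subsequence with means `M_N`, choose `N_l` such that
`M_{N_l} → X₀` a.s. and the integrals of `max (Ψ((M_{N_l} - X₀) / 4) - Ψ(b)) 0` are at most `2^{-l}`.
Their sum dominates `Ψ` of a multiple of `sup_l |M_{N_l}|` up to integrable terms
(`IsYoungFunction.exists_lintegral_iSup_le`), so the supremum lies in the Orlicz space.
-/

/-! ### Means and thinning of sequences -/

/-- The mean of the first `N` terms of a sequence in a real vector space; for `N = 0` it is `0`. -/
noncomputable def avg {E : Type*} [AddCommGroup E] [Module ℝ E] (x : ℕ → E) (N : ℕ) : E :=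
  (N : ℝ)⁻¹ • ∑ i ∈ Finset.range N, x i

/-- A diagonal extraction for relations between pairs: if for fixed `t` and `i` the relation `Q t i j`
holds for all large `j`, then along a subsequence it holds between the terms of index `i < j` with
`t = j`. -/
theorem exists_strictMono_forall_lt {Q : ℕ → ℕ → ℕ → Prop} (hQ : ∀ t i, ∀ᶠ j in atTop, Q t i j) :
    ∃ φ : ℕ → ℕ, StrictMono φ ∧ ∀ i j, i < j → Q j (φ i) (φ j) := by
  -- Each chosen index carries a strictly increasing label, which bounds its position from above.
  obtain ⟨f, -, hf⟩ := exists_seq_of_forall_finset_exists (α := ℕ × ℕ) (fun _ => True)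
    (fun a b => a.1 < b.1 ∧ a.2 < b.2 ∧ ∀ t ≤ b.2, Q t a.1 b.1) (by
      intro s _
      obtain ⟨T, hT⟩ : ∃ T : ℕ, ∀ a ∈ s, a.2 < T :=
        ⟨s.sup (fun a => a.2) + 1, fun a ha =>
          Nat.lt_succ_of_le (Finset.le_sup (f := fun a : ℕ × ℕ => a.2) ha)⟩
      have h1 : ∀ᶠ j in atTop, ∀ a ∈ s, a.1 < j ∧ ∀ t ∈ Finset.range (T + 1), Q t a.1 j := by
        rw [Filter.eventually_all_finset]
        intro a _
        refine (eventually_gt_atTop a.1).and ?_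
        rw [Filter.eventually_all_finset]
        exact fun t _ => hQ t a.1
      obtain ⟨j, hj⟩ := h1.exists
      exact ⟨(j, T), trivial, fun a ha => ⟨(hj a ha).1, hT a ha, fun t ht =>
        (hj a ha).2 t (Finset.mem_range.2 (Nat.lt_succ_of_le ht))⟩⟩)
  have hmono : StrictMono fun n => (f n).2 := fun i j hij => (hf i j hij).2.1
  exact ⟨fun n => (f n).1, fun i j hij => (hf i j hij).1,
    fun i j hij => (hf i j hij).2.2 j hmono.le_apply⟩

/-! ### The Banach-Saks property in Hilbert space -/

section Hilbert

variable {H : Type*} [NormedAddCommGroup H] [InnerProductSpace ℝ H]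

theorem sum_half_pow_le_two (n : ℕ) : ∑ i ∈ Finset.range n, (1 / 2 : ℝ) ^ i ≤ 2 :=
  (summable_geometric_two.sum_le_tsum _ fun _ _ => by positivity).trans_eq tsum_geometric_two

/-- If the mixed Gram matrix of two sequences is, off the entries with `k i = k' j`, within a summable
error of a constant `h`, then the inner products of their means tend to `h`. -/
theorem abs_inner_avg_sub_le {a b : ℕ → H} {h D : ℝ} {k k' : ℕ → ℕ} (hk' : Function.Injective k')
    (hD : 0 ≤ D)
    (hab : ∀ i j, |inner ℝ (a i) (b j) - h| ≤
      2 * ((1 / 2) ^ i + (1 / 2) ^ j) + if k i = k' j then D else 0)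
    {N L : ℕ} (hN : 0 < N) (hL : 0 < L) :
    |inner ℝ (avg a N) (avg b L) - h| ≤ 4 * (N : ℝ)⁻¹ + (4 + D) * (L : ℝ)⁻¹ := by
  have hN' : (0 : ℝ) < N := by exact_mod_cast hN
  have hL' : (0 : ℝ) < L := by exact_mod_cast hL
  have h1 : inner ℝ (avg a N) (avg b L) - h = (N : ℝ)⁻¹ * (L : ℝ)⁻¹ *
      ∑ i ∈ Finset.range N, ∑ j ∈ Finset.range L, (inner ℝ (a i) (b j) - h) := by
    simp only [avg, inner_smul_left, inner_smul_right, sum_inner, inner_sum,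
      Finset.sum_sub_distrib, Finset.sum_const, Finset.card_range, nsmul_eq_mul, RCLike.conj_to_real]
    rw [Finset.sum_comm]
    simp only [← Finset.mul_sum]
    field_simp
  have h2 : ∀ i, ∑ j ∈ Finset.range L, |inner ℝ (a i) (b j) - h| ≤
      2 * (L * (1 / 2) ^ i + 2) + D := by
    intro i
    have h3 : ∑ j ∈ Finset.range L, (if k i = k' j then D else 0) ≤ D := by
      rw [Finset.sum_ite, Finset.sum_const_zero, add_zero, Finset.sum_const, nsmul_eq_mul]
      have : (Finset.filter (fun j => k i = k' j) (Finset.range L)).card ≤ 1 := by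
        rw [Finset.card_le_one]
        intro x hx y hy
        exact hk' ((Finset.mem_filter.1 hx).2.symm.trans (Finset.mem_filter.1 hy).2)
      have : ((Finset.filter (fun j => k i = k' j) (Finset.range L)).card : ℝ) ≤ 1 := by
        exact_mod_cast this
      nlinarith
    calc _ ≤ ∑ j ∈ Finset.range L, (2 * ((1 / 2) ^ i + (1 / 2) ^ j) +
          if k i = k' j then D else 0) := Finset.sum_le_sum fun j _ => hab i j
      _ ≤ _ := by
        rw [Finset.sum_add_distrib, ← Finset.mul_sum, Finset.sum_add_distrib, Finset.sum_const,
          Finset.card_range, nsmul_eq_mul]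
        linarith [sum_half_pow_le_two L]
  have h3 : |∑ i ∈ Finset.range N, ∑ j ∈ Finset.range L, (inner ℝ (a i) (b j) - h)| ≤
      4 * L + (4 + D) * N := by
    calc _ ≤ ∑ i ∈ Finset.range N, (2 * (L * (1 / 2 : ℝ) ^ i + 2) + D) :=
          (Finset.abs_sum_le_sum_abs _ _).trans (Finset.sum_le_sum fun i _ =>
            (Finset.abs_sum_le_sum_abs _ _).trans (h2 i))
      _ ≤ _ := by
        rw [Finset.sum_add_distrib, ← Finset.mul_sum, Finset.sum_add_distrib, ← Finset.mul_sum,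
          Finset.sum_const, Finset.sum_const, Finset.card_range, nsmul_eq_mul, nsmul_eq_mul]
        nlinarith [sum_half_pow_le_two N]
  rw [h1, abs_mul, abs_of_pos (by positivity)]
  calc _ ≤ (N : ℝ)⁻¹ * (L : ℝ)⁻¹ * (4 * L + (4 + D) * N) := by gcongr
    _ = _ := by field_simp

/-- A bounded sequence has a subsequence whose Gram matrix is nearly constant off the diagonal. -/
theorem exists_subseq_inner_near_const {x : ℕ → H} {B : ℝ} (hx : ∀ n, ‖x n‖ ≤ B) :
    ∃ φ : ℕ → ℕ, StrictMono φ ∧ ∃ h : ℝ, ∀ i j, i < j →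
      |inner ℝ (x (φ i)) (x (φ j)) - h| ≤ 2 * (1 / 2) ^ i := by
  have hB : ∀ i j, inner ℝ (x i) (x j) ∈ Set.Icc (-(B * B)) (B * B) := fun i j => by
    rw [Set.mem_Icc, ← abs_le]
    exact (abs_real_inner_le_norm _ _).trans
      (mul_le_mul (hx i) (hx j) (norm_nonneg _) ((norm_nonneg _).trans (hx i)))
  -- First the entries of each row converge, to `g i`, then `g` converges, to `h`.
  obtain ⟨g, hg, φ₁, hφ₁, hlim₁⟩ := (isCompact_univ_pi fun _ : ℕ =>
    isCompact_Icc (a := -(B * B)) (b := B * B)).tendsto_subseq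
      (x := fun j i => inner ℝ (x i) (x j)) (fun j => Set.mem_univ_pi.2 fun i => hB i j)
  rw [tendsto_pi_nhds] at hlim₁
  obtain ⟨h, -, φ₂, hφ₂, hlim₂⟩ := (isCompact_Icc (a := -(B * B)) (b := B * B)).tendsto_subseq
    (x := fun i => g (φ₁ i)) (fun i => Set.mem_univ_pi.1 hg _)
  obtain ⟨φ₃, hφ₃, hlim₃⟩ := extraction_forall_of_eventually'
    (P := fun n i => |g (φ₁ (φ₂ i)) - h| ≤ (1 / 2) ^ n) (fun n => by
      refine eventually_atTop.1 ?_
      filter_upwards [hlim₂.eventually (Metric.closedBall_mem_nhds h (ε := (1 / 2) ^ n)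
        (by positivity))] with i hi
      simpa [Real.dist_eq] using hi)
  set ψ := fun i => φ₁ (φ₂ (φ₃ i)) with hψ
  have hψm : StrictMono ψ := hφ₁.comp (hφ₂.comp hφ₃)
  obtain ⟨φ₄, hφ₄, h₄⟩ := exists_strictMono_forall_lt
    (Q := fun t i j => |inner ℝ (x (ψ i)) (x (ψ j)) - g (ψ i)| ≤ (1 / 2) ^ t) (fun t i => by
      have := (hlim₁ (ψ i)).comp (hφ₂.comp hφ₃).tendsto_atTop
      filter_upwards [this.eventually (Metric.closedBall_mem_nhds _ (ε := (1 / 2) ^ t)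
        (by positivity))] with j hj
      simpa [Real.dist_eq] using hj)
  refine ⟨ψ ∘ φ₄, hψm.comp hφ₄, h, fun i j hij => ?_⟩
  have e1 := h₄ i j hij
  have e2 : |g (ψ (φ₄ i)) - h| ≤ (1 / 2) ^ i := (hlim₃ (φ₄ i)).trans
    (pow_le_pow_of_le_one (by norm_num) (by norm_num) hφ₄.le_apply)
  have e3 : (1 / 2 : ℝ) ^ j ≤ (1 / 2) ^ i :=
    pow_le_pow_of_le_one (by norm_num) (by norm_num) hij.le
  calc _ ≤ |inner ℝ (x (ψ (φ₄ i))) (x (ψ (φ₄ j))) - g (ψ (φ₄ i))| + |g (ψ (φ₄ i)) - h| :=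
        abs_sub_le _ _ _
    _ ≤ _ := by linarith

/-- Banach-Saks in Hilbert space: the means of every further subsequence are asymptotically equal to
those of the subsequence `φ` itself; `k = id` says that the latter are Cauchy. The Gram matrix alone
decides this, so no weak limit is needed. -/
theorem exists_subseq_avg_cauchy {x : ℕ → H} {B : ℝ} (hx : ∀ n, ‖x n‖ ≤ B) :
    ∃ φ : ℕ → ℕ, StrictMono φ ∧ ∀ k : ℕ → ℕ, StrictMono k →
      Tendsto (fun p : ℕ × ℕ => ‖avg (fun i => x (φ (k i))) p.1 - avg (fun i => x (φ i)) p.2‖)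
        atTop (𝓝 0) := by
  obtain ⟨φ, hφ, h, hh⟩ := exists_subseq_inner_near_const hx
  refine ⟨φ, hφ, fun k hk => ?_⟩
  set D := B * B + |h|
  have hD : 0 ≤ D := add_nonneg (mul_self_nonneg B) (abs_nonneg h)
  have key : ∀ k k' : ℕ → ℕ, StrictMono k → StrictMono k' → ∀ i j,
      |inner ℝ (x (φ (k i))) (x (φ (k' j))) - h| ≤
        2 * ((1 / 2) ^ i + (1 / 2) ^ j) + if k i = k' j then D else 0 := by
    intro k k' hk hk' i j
    have p1 : (1 / 2 : ℝ) ^ k i ≤ (1 / 2) ^ i :=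
      pow_le_pow_of_le_one (by norm_num) (by norm_num) hk.le_apply
    have p2 : (1 / 2 : ℝ) ^ k' j ≤ (1 / 2) ^ j :=
      pow_le_pow_of_le_one (by norm_num) (by norm_num) hk'.le_apply
    have q1 : (0 : ℝ) ≤ (1 / 2) ^ i := by positivity
    have q2 : (0 : ℝ) ≤ (1 / 2) ^ j := by positivity
    rcases lt_trichotomy (k i) (k' j) with hij | hij | hij
    · rw [if_neg hij.ne]
      linarith [hh _ _ hij]
    · rw [if_pos hij]
      have e1 := (abs_real_inner_le_norm (x (φ (k i))) (x (φ (k' j)))).trans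
        (mul_le_mul (hx _) (hx _) (norm_nonneg _) ((norm_nonneg _).trans (hx 0)))
      have := abs_sub (inner ℝ (x (φ (k i))) (x (φ (k' j)))) h
      simp only [D]
      linarith
    · rw [if_neg hij.ne', real_inner_comm]
      linarith [hh _ _ hij]
  set a := fun i => x (φ (k i))
  set b := fun i => x (φ i)
  have hinv : Tendsto (fun n : ℕ => (n : ℝ)⁻¹) atTop (𝓝 0) := tendsto_inv_atTop_nhds_zero_nat
  have hN : Tendsto (fun p : ℕ × ℕ => ((p.1 : ℝ))⁻¹) atTop (𝓝 0) := by
    rw [← prod_atTop_atTop_eq]; exact hinv.comp tendsto_fst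
  have hL : Tendsto (fun p : ℕ × ℕ => ((p.2 : ℝ))⁻¹) atTop (𝓝 0) := by
    rw [← prod_atTop_atTop_eq]; exact hinv.comp tendsto_snd
  have hsq : Tendsto (fun p : ℕ × ℕ => ‖avg a p.1 - avg b p.2‖ ^ 2) atTop (𝓝 0) := by
    refine squeeze_zero' (Eventually.of_forall fun p => sq_nonneg _)
      (g := fun p : ℕ × ℕ => (16 + D) * (p.1 : ℝ)⁻¹ + (16 + 3 * D) * (p.2 : ℝ)⁻¹) ?_ ?_
    · filter_upwards [eventually_ge_atTop ((1, 1) : ℕ × ℕ)] with p hp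
      have h1 : 0 < p.1 := hp.1
      have h2 : 0 < p.2 := hp.2
      have haa := abs_le.1 (abs_inner_avg_sub_le hk.injective hD (key k k hk hk) h1 h1)
      have hab := abs_le.1 (abs_inner_avg_sub_le Function.injective_id hD
        (key k id hk strictMono_id) h1 h2)
      have hbb := abs_le.1 (abs_inner_avg_sub_le Function.injective_id hD
        (key id id strictMono_id strictMono_id) h2 h2)
      rw [norm_sub_sq_real, ← real_inner_self_eq_norm_sq, ← real_inner_self_eq_norm_sq]
      simp only [a, b, id] at *
      linarith [haa.2, hab.1, hbb.2]
    · simpa using (hN.const_mul (16 + D)).add (hL.const_mul (16 + 3 * D))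
  have := hsq.sqrt
  simpa [Real.sqrt_sq (norm_nonneg _)] using this

theorem lp_avg_apply (x : ℕ → lp (fun _ : ℕ => H) 2) (N m : ℕ) :
    avg x N m = avg (fun i => x i m) N := by
  unfold avg
  rw [lp.coeFn_smul, Pi.smul_apply, lp.coeFn_sum, Finset.sum_apply]

theorem lp_norm_sub_apply_le {H : Type*} [NormedAddCommGroup H] (u v : lp (fun _ : ℕ => H) 2)
    (m : ℕ) : ‖u m - v m‖ ≤ ‖u - v‖ :=
  lp.norm_apply_le_norm two_ne_zero (u - v) m

/-- Countably many bounded sequences share one subsequence with the Banach-Saks property: with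
suitable weights they form a single bounded sequence in a Hilbert sum. -/
theorem exists_subseq_avg_cauchy_family {y : ℕ → ℕ → H} {c : ℕ → ℝ} (hy : ∀ m n, ‖y m n‖ ≤ c m) :
    ∃ φ : ℕ → ℕ, StrictMono φ ∧ ∀ m, ∀ k : ℕ → ℕ, StrictMono k →
      Tendsto (fun p : ℕ × ℕ => ‖avg (fun i => y m (φ (k i))) p.1 -
        avg (fun i => y m (φ i)) p.2‖) atTop (𝓝 0) := by
  have hc : ∀ m, 0 ≤ c m := fun m => (norm_nonneg _).trans (hy m 0)
  set w : ℕ → ℝ := fun m => (1 / 2) ^ m * (1 + c m)⁻¹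
  have hw : ∀ m, 0 < w m := fun m => by have := hc m; positivity
  have hle : ∀ m n, ‖w m • y m n‖ ^ 2 ≤ (1 / 4 : ℝ) ^ m := fun m n => by
    rw [norm_smul, Real.norm_of_nonneg (hw m).le]
    have : w m * ‖y m n‖ ≤ (1 / 2) ^ m := by
      rw [mul_assoc]
      refine mul_le_of_le_one_right (by positivity) ?_
      rw [inv_mul_le_iff₀ (by linarith [hc m])]
      linarith [hy m n]
    calc _ ≤ ((1 / 2 : ℝ) ^ m) ^ 2 := by have := hw m; gcongr
      _ = _ := by rw [← pow_mul, mul_comm, pow_mul]; norm_num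
  have hsum : ∀ n, Summable fun m => ‖w m • y m n‖ ^ 2 := fun n =>
    Summable.of_nonneg_of_le (fun _ => sq_nonneg _) (fun m => hle m n)
      (summable_geometric_of_lt_one (by norm_num) (by norm_num))
  have hmem : ∀ n, Memℓp (fun m => w m • y m n) 2 := fun n => by
    refine memℓp_gen ?_
    simpa using hsum n
  let x : ℕ → lp (fun _ : ℕ => H) 2 := fun n => ⟨fun m => w m • y m n, hmem n⟩
  have hx : ∀ n, ‖x n‖ ≤ 2 := fun n => by
    refine lp.norm_le_of_tsum_le (by norm_num) (by norm_num) ?_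
    have := (hsum n).tsum_le_tsum (fun m => hle m n)
      (summable_geometric_of_lt_one (by norm_num) (by norm_num))
    rw [tsum_geometric_of_lt_one (by norm_num) (by norm_num)] at this
    have h4 : (1 - 1 / 4 : ℝ)⁻¹ ≤ 4 := by norm_num
    simpa [x] using this.trans (h4.trans (by norm_num))
  obtain ⟨φ, hφ, h⟩ := exists_subseq_avg_cauchy hx
  refine ⟨φ, hφ, fun m k hk => ?_⟩
  have hcoe : ∀ (κ : ℕ → ℕ) N, (avg (fun i => x (κ i)) N : lp (fun _ : ℕ => H) 2) m =
      w m • avg (fun i => y m (κ i)) N := fun κ N => by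
    rw [lp_avg_apply]
    change avg (fun i => w m • y m (κ i)) N = _
    unfold avg
    rw [← Finset.smul_sum, smul_comm]
  refine squeeze_zero (fun _ => norm_nonneg _) (fun p => ?_)
    (by simpa using (h k hk).const_mul (w m)⁻¹)
  have hle := lp_norm_sub_apply_le (avg (fun i => x (φ (k i))) p.1) (avg (fun i => x (φ i)) p.2) m
  rw [hcoe (fun i => φ (k i)), hcoe, ← smul_sub, norm_smul, Real.norm_of_nonneg (hw m).le] at hle
  exact (le_inv_mul_iff₀ (hw m)).2 hle

end Hilbert


/-- A sequence in a Banach space that is approximated, uniformly in `n`, by images of bounded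
sequences in a Hilbert space inherits the Banach-Saks property. -/

theorem exists_subseq_avg_tendsto {E H : Type*} [NormedAddCommGroup E] [NormedSpace ℝ E]
    [CompleteSpace E] [NormedAddCommGroup H] [InnerProductSpace ℝ H] (T : H →ₗ[ℝ] E)
    (hT : ∀ y, ‖T y‖ ≤ ‖y‖) {x : ℕ → E} {y : ℕ → ℕ → H} {c : ℕ → ℝ} (hy : ∀ m n, ‖y m n‖ ≤ c m)
    (hxy : ∀ ε > 0, ∃ m, ∀ n, ‖x n - T (y m n)‖ ≤ ε) :
    ∃ φ : ℕ → ℕ, StrictMono φ ∧ ∃ x₀ : E, ∀ k : ℕ → ℕ, StrictMono k →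
      Tendsto (fun N => avg (fun i => x (φ (k i))) N) atTop (𝓝 x₀) := by
  obtain ⟨φ, hφ, h⟩ := exists_subseq_avg_cauchy_family hy
  have hdist : ∀ m ε, 0 ≤ ε → (∀ n, ‖x n - T (y m n)‖ ≤ ε) → ∀ (κ : ℕ → ℕ) N,
      ‖avg (fun i => x (κ i)) N - T (avg (fun i => y m (κ i)) N)‖ ≤ ε := by
    intro m ε hε hm κ N
    simp only [avg, map_smul, map_sum]
    rw [← smul_sub, ← Finset.sum_sub_distrib, norm_smul, norm_inv, Real.norm_natCast]
    calc _ ≤ (N : ℝ)⁻¹ * (N * ε) := by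
          gcongr
          refine (norm_sum_le_of_le _ fun i _ => hm (κ i)).trans ?_
          simp
      _ ≤ ε := by
          rcases eq_or_ne (N : ℝ) 0 with h0 | h0
          · simpa [h0] using hε
          · rw [inv_mul_cancel_left₀ h0]
  have hcau : ∀ k : ℕ → ℕ, StrictMono k →
      Tendsto (fun p : ℕ × ℕ => ‖avg (fun i => x (φ (k i))) p.1 - avg (fun i => x (φ i)) p.2‖)
        atTop (𝓝 0) := by
    intro k hk
    rw [Metric.tendsto_nhds]
    intro ε hε
    obtain ⟨m, hm⟩ := hxy (ε / 4) (by positivity)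
    filter_upwards [(h m k hk).eventually (gt_mem_nhds (by positivity : 0 < ε / 4))] with p hp
    have e1 := hdist m (ε / 4) (by positivity) hm (fun i => φ (k i)) p.1
    have e2 := hdist m (ε / 4) (by positivity) hm φ p.2
    have e3 := (hT (avg (fun i => y m (φ (k i))) p.1 - avg (fun i => y m (φ i)) p.2)).trans_lt hp
    rw [map_sub, ← dist_eq_norm] at e3
    rw [← dist_eq_norm] at e1 e2 ⊢
    rw [dist_zero_right, Real.norm_of_nonneg dist_nonneg]
    have e4 := dist_triangle4_right (avg (fun i => x (φ (k i))) p.1) (avg (fun i => x (φ i)) p.2)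
      (T (avg (fun i => y m (φ (k i))) p.1)) (T (avg (fun i => y m (φ i)) p.2))
    linarith
  have hC : CauchySeq fun N => avg (fun i => x (φ i)) N := by
    rw [cauchySeq_iff_tendsto_dist_atTop_0]
    simpa [dist_eq_norm] using hcau id strictMono_id
  obtain ⟨x₀, hx₀⟩ := cauchySeq_tendsto_of_complete hC
  refine ⟨φ, hφ, x₀, fun k hk => ?_⟩
  have hdiag : Tendsto (fun N : ℕ => (N, N)) atTop (atTop : Filter (ℕ × ℕ)) := by
    rw [← prod_atTop_atTop_eq]; exact tendsto_id.prodMk tendsto_id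
  have h1 := (hcau k hk).comp hdiag
  have h0 := tendsto_zero_iff_norm_tendsto_zero.2 h1
  simpa using h0.add hx₀

/-! ### Young functions and the growth of the conjugate -/

theorem ConvexOn.le_of_abs_le {g : ℝ → ℝ} (hg : ConvexOn ℝ Set.univ g) (heven : ∀ x, g (-x) = g x)
    {x y : ℝ} (h : |x| ≤ |y|) : g x ≤ g y := by
  have hy : g |y| = g y := by
    rcases abs_choice y with h | h <;> rw [h]
    exact heven y
  have hmem : x ∈ segment ℝ (-|y|) |y| := by
    rw [segment_eq_Icc (neg_le_self (abs_nonneg y))]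
    exact abs_le.1 h
  have := hg.le_on_segment (Set.mem_univ _) (Set.mem_univ _) hmem
  rwa [heven, max_self, hy] at this

theorem ConvexOn.continuous_of_univ {g : ℝ → ℝ} (hg : ConvexOn ℝ Set.univ g) : Continuous g :=
  continuousOn_univ.1 (hg.continuousOn isOpen_univ)

theorem ConvexOn.map_avg_le {g : ℝ → ℝ} (hg : ConvexOn ℝ Set.univ g) (x : ℕ → ℝ) {N : ℕ}
    (hN : 0 < N) : g (avg x N) ≤ avg (fun i => g (x i)) N := by
  have hN' : (N : ℝ) ≠ 0 := by positivity
  have := hg.map_sum_le (t := Finset.range N) (w := fun _ => (N : ℝ)⁻¹) (p := x)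
    (fun _ _ => by positivity) (by simp [hN']) (fun _ _ => Set.mem_univ _)
  simpa [avg, Finset.smul_sum, Finset.mul_sum] using this

namespace IsYoungFunction

variable {Ψ : ℝ → ℝ}

theorem le_of_abs_le (h : IsYoungFunction Ψ) {x y : ℝ} (hxy : |x| ≤ |y|) : Ψ x ≤ Ψ y :=
  h.convexOn.le_of_abs_le h.even hxy

theorem continuous (h : IsYoungFunction Ψ) : Continuous Ψ := h.convexOn.continuous_of_univ

theorem map_mul_le (h : IsYoungFunction Ψ) {t : ℝ} (ht0 : 0 ≤ t) (ht1 : t ≤ 1) (x : ℝ) :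
    Ψ (t * x) ≤ t * Ψ x := by
  have := h.convexOn.2 (Set.mem_univ x) (Set.mem_univ 0) ht0 (sub_nonneg.2 ht1) (by ring)
  simpa [h.map_zero] using this

/-- Coercivity in the form that bounds `L¹` tails by the modular. -/
theorem exists_abs_le_mul (h : IsYoungFunction Ψ) {ε : ℝ} (hε : 0 < ε) :
    ∃ m : ℕ, ∀ x, (m : ℝ) ≤ |x| → |x| ≤ ε * Ψ x := by
  obtain ⟨a, ha⟩ := eventually_atTop.1 (h.coercive.eventually_ge_atTop ε⁻¹)
  obtain ⟨m, hm⟩ := exists_nat_ge (max a 1)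
  refine ⟨m, fun x hx => ?_⟩
  have hx1 : 0 < |x| := by linarith [le_max_right a 1]
  have := ha |x| ((le_max_left _ _).trans (hm.trans hx))
  rw [le_div_iff₀ hx1, inv_mul_le_iff₀ hε] at this
  exact this.trans (by gcongr; exact h.le_of_abs_le (by simp))

end IsYoungFunction

theorem SatisfiesDeltaTwo.exists_le_mul {Φ : ℝ → ℝ} (hΦ : IsYoungFunction Φ)
    (hΔ : SatisfiesDeltaTwo Φ) : ∃ C : ℝ, 4 ≤ C ∧ ∃ a : ℝ, 0 ≤ a ∧ ∀ x, a ≤ x →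
      Φ (2 * x) ≤ C * Φ x := by
  obtain ⟨C, hC1, hC2⟩ := EReal.lt_iff_exists_real_btwn.1 hΔ
  have h1 := eventually_lt_of_limsup_lt hC1
  have h2 := hΦ.coercive.eventually_gt_atTop 0
  obtain ⟨a, ha⟩ := eventually_atTop.1 (h1.and (h2.and (eventually_gt_atTop (0 : ℝ))))
  refine ⟨max C 4, le_max_right _ _, max a 0, le_max_right _ _, fun x hx => ?_⟩
  obtain ⟨hx1, hx2, hx3⟩ := ha x ((le_max_left _ _).trans hx)
  have hpos : 0 < Φ x := by
    have := mul_pos hx2 hx3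
    rwa [div_mul_cancel₀ _ hx3.ne'] at this
  have hx4 : Φ (2 * x) / Φ x < C := by exact_mod_cast hx1
  rw [div_lt_iff₀ hpos] at hx4
  exact hx4.le.trans (by gcongr; exact le_max_left _ _)

/-- The dual form of the `Δ₂`-condition. -/
theorem SatisfiesDeltaTwo.conjugate_growth {Φ : ℝ → ℝ} (hΦ : IsYoungFunction Φ)
    (hΔ : SatisfiesDeltaTwo Φ) : ∃ K : ℝ, 2 ≤ K ∧ ∃ b : ℝ, 0 ≤ b ∧ ∀ y, b ≤ y →
      2 * K * youngConjugate Φ y ≤ youngConjugate Φ (K * y) := by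
  obtain ⟨C, hC, a, ha, h⟩ := hΔ.exists_le_mul hΦ
  -- For `y ≥ Φ (a + 1)` the value of `x y - Φ x` at `a + 1` exceeds all its values at `x ≤ a`, so
  -- the supremum that defines the conjugate may be taken over `x ≥ a`, where `Φ` is doubling.
  refine ⟨C / 2, by linarith, Φ (a + 1), hΦ.nonneg _, fun y hy => ?_⟩
  have key : ∀ x, a ≤ x → C * (x * y - Φ x) ≤ youngConjugate Φ (C / 2 * y) := by
    intro x hx
    have := le_ciSup (hΦ.bddAbove_conjugate (C / 2 * y)) (2 * x)
    change _ ≤ youngConjugate Φ _ at this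
    linarith [h x hx]
  rw [mul_div_cancel₀ _ two_ne_zero, ← le_div_iff₀' (by linarith)]
  refine ciSup_le fun x => ?_
  rw [le_div_iff₀' (by linarith)]
  rcases le_total a x with hx | hx
  · exact key x hx
  · refine le_trans ?_ (key (a + 1) (by linarith))
    have h0 := (hΦ.nonneg (a + 1)).trans hy
    have : x * y ≤ a * y := by gcongr
    exact mul_le_mul_of_nonneg_left (by linarith [hΦ.nonneg x]) (by linarith)

/-- Iteration of the growth condition: `Ψ y` is of smaller order than `Ψ (N y) / N` as `N → ∞`,
uniformly in `|y| ≥ b`. -/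
theorem IsYoungFunction.eventually_mul_div_le {Ψ : ℝ → ℝ} (hΨ : IsYoungFunction Ψ) {K b : ℝ}
    (hK : 2 ≤ K) (hb : 0 ≤ b) (h : ∀ y, b ≤ y → 2 * K * Ψ y ≤ Ψ (K * y)) {ε : ℝ} (hε : 0 < ε) :
    ∀ᶠ N : ℕ in atTop, ∀ y, b ≤ |y| → N * Ψ y ≤ ε * Ψ (N * y) := by
  have hpow : ∀ m : ℕ, ∀ y, b ≤ y → (2 * K) ^ m * Ψ y ≤ Ψ (K ^ m * y) := by
    intro m
    induction m with
    | zero => intro y _; simp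
    | succ m ih =>
      intro y hy
      have h1 : b ≤ K * y := hy.trans (le_mul_of_one_le_left (hb.trans hy) (by linarith))
      have h2 : K ^ (m + 1) * y = K ^ m * (K * y) := by ring
      calc (2 * K) ^ (m + 1) * Ψ y = (2 * K) ^ m * (2 * K * Ψ y) := by ring
        _ ≤ (2 * K) ^ m * Ψ (K * y) := by gcongr; exact h y hy
        _ ≤ _ := by rw [h2]; exact ih _ h1
  obtain ⟨m, hm⟩ := exists_pow_lt_of_lt_one hε (by norm_num : (1 / 2 : ℝ) < 1)
  have hKm : 0 < K ^ m := by positivity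
  obtain ⟨N₀, hN₀⟩ := exists_nat_ge (K ^ m)
  filter_upwards [eventually_ge_atTop N₀] with N hN y hy
  have hN1 : K ^ m ≤ N := hN₀.trans (by exact_mod_cast hN)
  have hNpos : (0 : ℝ) < N := hKm.trans_le hN1
  have habs : ∀ z, Ψ |z| = Ψ z := fun z =>
    le_antisymm (hΨ.le_of_abs_le (by simp)) (hΨ.le_of_abs_le (by simp))
  have h1 := hpow m |y| hy
  have h2 := hΨ.map_mul_le (t := K ^ m / N) (by positivity) ((div_le_one hNpos).2 hN1) (N * |y|)
  have h3 : K ^ m / N * (N * |y|) = K ^ m * |y| := by field_simp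
  have h4 : Ψ (N * |y|) = Ψ (N * y) := by rw [← habs (N * y), abs_mul, Nat.abs_cast]
  rw [h3, h4] at h2
  rw [habs, mul_pow] at h1
  have h5 : (2 : ℝ) ^ m * (N * Ψ y) ≤ Ψ (N * y) := by
    have := h1.trans h2
    rw [div_mul_eq_mul_div, le_div_iff₀ hNpos] at this
    refine le_of_mul_le_mul_left ?_ hKm
    linarith
  have h6 : (1 / 2 : ℝ) ^ m * 2 ^ m = 1 := by rw [← mul_pow]; norm_num
  calc N * Ψ y = (1 / 2 : ℝ) ^ m * (2 ^ m * (N * Ψ y)) := by rw [← mul_assoc, h6, one_mul]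
    _ ≤ ε * Ψ (N * y) := mul_le_mul hm.le h5 (by have := hΨ.nonneg y; positivity) hε.le

/-! ### Banach-Saks in `L¹` for sequences with bounded modular -/

section

variable {Ω : Type*} [MeasurableSpace Ω] {P : Measure Ω}

theorem AEEqFun.coeFn_avg (x : ℕ → Ω →ₘ[P] ℝ) (N : ℕ) :
    ⇑(avg x N) =ᵐ[P] avg (fun i => ⇑(x i)) N := by
  refine (AEEqFun.coeFn_smul _ _).trans ?_
  filter_upwards [AEEqFun.coeFn_finsetSum (Finset.range N) x] with ω hω
  simp only [avg, Pi.smul_apply, hω]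

theorem avg_apply {α : Type*} (x : ℕ → α → ℝ) (N : ℕ) (a : α) :
    avg x N a = avg (fun i => x i a) N := by
  simp [avg]

theorem measurable_avg {X : ℕ → Ω → ℝ} (hX : ∀ n, Measurable (X n)) (N : ℕ) :
    Measurable (avg X N) := by
  have : avg X N = fun ω => (N : ℝ)⁻¹ * ∑ i ∈ Finset.range N, X i ω := by
    ext ω
    simp [avg]
  rw [this]
  exact (Finset.measurable_sum _ fun i _ => hX i).const_mul _

/-- The inclusion of `L²` in `L¹` over a probability space. -/
noncomputable def lpTwoToOne (P : Measure Ω) [IsProbabilityMeasure P] :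
    Lp ℝ 2 P →ₗ[ℝ] Lp ℝ 1 P where
  toFun f := ⟨f.1, Lp.antitone (by norm_num) f.2⟩
  map_add' _ _ := rfl
  map_smul' _ _ := rfl

theorem norm_lpTwoToOne_le [IsProbabilityMeasure P] (f : Lp ℝ 2 P) :
    ‖lpTwoToOne P f‖ ≤ ‖f‖ := by
  rw [Lp.norm_def, Lp.norm_def]
  exact ENNReal.toReal_mono (Lp.eLpNorm_ne_top f)
    (eLpNorm_le_eLpNorm_of_exponent_le (by norm_num) (Lp.aestronglyMeasurable f))

/-- A sequence with bounded modular has a subsequence such that the means of all further subsequences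
converge in `L¹` to the same limit. -/
theorem IsYoungFunction.exists_subseq_avg_tendsto_eLpNorm [IsProbabilityMeasure P] {Ψ : ℝ → ℝ}
    (hΨ : IsYoungFunction Ψ) {X : ℕ → Ω → ℝ} (hX : ∀ n, Measurable (X n))
    (hbd : ∀ n, ∫⁻ ω, ENNReal.ofReal (Ψ (X n ω)) ∂P ≤ 1) :
    ∃ φ : ℕ → ℕ, StrictMono φ ∧ ∃ X₀ : Ω → ℝ, Measurable X₀ ∧ ∀ k : ℕ → ℕ, StrictMono k →
      Tendsto (fun N => eLpNorm (avg (fun i => X (φ (k i))) N - X₀) 1 P) atTop (𝓝 0) := by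
  set trunc : ℕ → ℝ → ℝ := fun m x => max (-m) (min x m)
  have htm : ∀ m, Measurable (trunc m) := fun m =>
    measurable_const.max (measurable_id.min measurable_const)
  have htb : ∀ m x, ‖trunc m x‖ ≤ m := fun m x => by
    have : (0 : ℝ) ≤ m := Nat.cast_nonneg m
    rw [Real.norm_eq_abs, abs_le]
    exact ⟨le_max_left _ _, max_le (by linarith) (min_le_right _ _)⟩
  have hst : ∀ ε > 0, ∃ m, ∀ n, eLpNorm (X n - trunc m ∘ X n) 1 P ≤ ENNReal.ofReal ε := by
    intro ε hε
    obtain ⟨m, hm⟩ := hΨ.exists_abs_le_mul hε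
    refine ⟨m, fun n => ?_⟩
    rw [eLpNorm_one_eq_lintegral_enorm]
    calc _ ≤ ∫⁻ ω, ENNReal.ofReal ε * ENNReal.ofReal (Ψ (X n ω)) ∂P := by
          refine lintegral_mono fun ω => ?_
          rw [← ENNReal.ofReal_mul hε.le, ← ofReal_norm]
          refine ENNReal.ofReal_le_ofReal ?_
          have hm0 : (0 : ℝ) ≤ m := Nat.cast_nonneg m
          have hp := mul_nonneg hε.le (hΨ.nonneg (X n ω))
          have hm1 := hm (X n ω)
          simp only [Pi.sub_apply, Function.comp, trunc, Real.norm_eq_abs]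
          rcases le_total |X n ω| m with h | h
          · have h' := abs_le.1 h
            rw [min_eq_left h'.2, max_eq_right h'.1]
            simpa using hp
          · refine le_trans ?_ (hm1 h)
            rcases le_abs'.1 h with h' | h'
            · rw [min_eq_left (by linarith), max_eq_left (by linarith), abs_of_nonpos (by linarith),
                abs_of_nonpos (by linarith)]
              linarith
            · rw [min_eq_right (by linarith), max_eq_right (by linarith),
                abs_of_nonneg (by linarith), abs_of_nonneg (by linarith)]
              linarith
      _ = ENNReal.ofReal ε * ∫⁻ ω, ENNReal.ofReal (Ψ (X n ω)) ∂P :=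
          lintegral_const_mul _ (hΨ.continuous.measurable.comp (hX n)).ennreal_ofReal
      _ ≤ _ := mul_le_of_le_one_right' (hbd n)
  have hty : ∀ p m n, MemLp (trunc m ∘ X n) p P := fun p m n =>
    MemLp.of_bound ((htm m).comp (hX n)).aestronglyMeasurable m (Eventually.of_forall fun ω => htb _ _)
  have hxm : ∀ n, MemLp (X n) 1 P := by
    intro n
    obtain ⟨m, hm⟩ := hst 1 one_pos
    have h1 : MemLp (X n - trunc m ∘ X n) 1 P :=
      ⟨((hX n).sub ((htm m).comp (hX n))).aestronglyMeasurable,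
        (hm n).trans_lt ENNReal.ofReal_lt_top⟩
    simpa using h1.add (hty 1 m n)
  obtain ⟨φ, hφ, x₀, h⟩ := exists_subseq_avg_tendsto (lpTwoToOne P) norm_lpTwoToOne_le
    (x := fun n => (hxm n).toLp (X n)) (y := fun m n => (hty 2 m n).toLp (trunc m ∘ X n))
    (c := fun m => m) (fun m n => by
      have := Lp.norm_le_of_ae_bound (f := (hty 2 m n).toLp (trunc m ∘ X n)) (Nat.cast_nonneg m) (by
        filter_upwards [(hty 2 m n).coeFn_toLp] with ω hω
        rw [hω]; exact htb _ _)
      simpa [measureUnivNNReal] using this)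
    (fun ε hε => by
      obtain ⟨m, hm⟩ := hst ε hε
      refine ⟨m, fun n => ?_⟩
      have : (hxm n).toLp (X n) - lpTwoToOne P ((hty 2 m n).toLp (trunc m ∘ X n)) =
        ((hxm n).sub (hty 1 m n)).toLp (X n - trunc m ∘ X n) := rfl
      rw [this, Lp.norm_toLp]
      exact ENNReal.toReal_le_of_le_ofReal hε.le (hm n))
  refine ⟨φ, hφ, x₀, (Lp.stronglyMeasurable x₀).measurable, fun k hk => ?_⟩
  have h1 := (Lp.tendsto_Lp_iff_tendsto_eLpNorm' _ _).1 (h k hk)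
  refine h1.congr fun N => eLpNorm_congr_ae ?_
  have h2 : ((avg (fun i => (hxm (φ (k i))).toLp (X (φ (k i)))) N : Lp ℝ 1 P) : Ω →ₘ[P] ℝ) =
      avg (fun i => ((hxm (φ (k i))).toLp (X (φ (k i))) : Ω →ₘ[P] ℝ)) N :=
    congrArg ((N : ℝ)⁻¹ • ·) (map_sum (Lp ℝ 1 P).subtype _ _)
  have h3 : ∀ᵐ ω ∂P, ∀ n, ((hxm n).toLp (X n)) ω = X n ω :=
    ae_all_iff.2 fun n => (hxm n).coeFn_toLp
  filter_upwards [AEEqFun.coeFn_avg (fun i => ((hxm (φ (k i))).toLp (X (φ (k i))) : Ω →ₘ[P] ℝ)) N,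
    h3] with ω hω h3
  rw [Pi.sub_apply, Pi.sub_apply, h2, hω, avg_apply, avg_apply]
  simp only [h3]

end

/-! ### Splitting of bounded sequences in `L¹` -/

section

open scoped ENNReal

variable {Ω : Type*} [MeasurableSpace Ω] {P : Measure Ω}

/-- Along a subsequence of a bounded sequence in `L¹`, the mass of the `k`-th term between the levels
`b` and `k` is eventually small. The mass that escapes to infinity, `c` in the proof, is almost
attained by each term of the subsequence above its own level `k`, and asymptotically no term has more
than `c + ε` above a high fixed level. -/
theorem exists_subseq_middle_small {f : ℕ → Ω → ℝ≥0∞} (hf : ∀ n, Measurable (f n))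
    (hbd : ∀ n, ∫⁻ ω, f n ω ∂P ≤ 1) :
    ∃ φ : ℕ → ℕ, StrictMono φ ∧ ∀ ε : ℝ≥0∞, 0 < ε → ∃ b : ℕ, ∀ᶠ k : ℕ in atTop,
      ∫⁻ ω in {ω | (b : ℝ≥0∞) < f (φ k) ω} \ {ω | (k : ℝ≥0∞) < f (φ k) ω}, f (φ k) ω ∂P ≤ ε := by
  set S : ℕ → ℕ → Set Ω := fun n a => {ω | (a : ℝ≥0∞) < f n ω}
  have hS : ∀ n a, MeasurableSet (S n a) := fun n a => measurableSet_lt measurable_const (hf n)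
  set I : ℕ → ℕ → ℝ≥0∞ := fun n a => ∫⁻ ω in S n a, f n ω ∂P
  have hI : ∀ n a, I n a ≤ 1 := fun n a => (setLIntegral_le_lintegral _ _).trans (hbd n)
  set s : ℕ → ℝ≥0∞ := fun a => limsup (fun n => I n a) atTop
  set c : ℝ≥0∞ := ⨅ a, s a
  have hc : c ≠ ∞ := ((iInf_le s 0).trans (limsup_le_of_le (by isBoundedDefault)
    (Eventually.of_forall fun n => hI n 0))).trans_lt ENNReal.one_lt_top |>.ne
  obtain ⟨φ, hφ, hφI⟩ := extraction_forall_of_frequently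
    (P := fun k n => c ≤ I n k + ((k : ℝ≥0∞))⁻¹) (fun k => by
      by_contra hcon
      rw [not_frequently] at hcon
      have h1 : limsup (fun n => I n k) atTop ≤ c - (k : ℝ≥0∞)⁻¹ := by
        refine limsup_le_of_le (by isBoundedDefault) ?_
        filter_upwards [hcon] with n hn
        exact ENNReal.le_sub_of_add_le_right (ne_top_of_le_ne_top hc
          (le_add_self.trans (not_le.1 hn).le)) (not_le.1 hn).le
      have h2 : c ≤ c - (k : ℝ≥0∞)⁻¹ := (iInf_le s k).trans h1
      obtain ⟨n, hn⟩ := hcon.exists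
      have h3 : c ≠ 0 := (bot_le.trans_lt (not_le.1 hn)).ne'
      exact absurd h2 (not_le.2 (ENNReal.sub_lt_self hc h3 (by simp))))
  refine ⟨φ, hφ, fun ε hε => ?_⟩
  have hε2 : ε / 2 ≠ 0 := (ENNReal.half_pos hε.ne').ne'
  obtain ⟨b, hb⟩ := iInf_lt_iff.1 (ENNReal.lt_add_right hc hε2)
  refine ⟨b, ?_⟩
  filter_upwards [hφ.tendsto_atTop.eventually (eventually_lt_of_limsup_lt hb),
    (ENNReal.tendsto_inv_nat_nhds_zero).eventually (gt_mem_nhds (pos_iff_ne_zero.2 hε2)),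
    eventually_ge_atTop b] with k h1 h2 h3
  have hsub : S (φ k) b ∩ S (φ k) k = S (φ k) k :=
    Set.inter_eq_right.2 fun ω (hω : (k : ℝ≥0∞) < f (φ k) ω) =>
      show (b : ℝ≥0∞) < f (φ k) ω from lt_of_le_of_lt (by exact_mod_cast h3) hω
  have h4 := lintegral_inter_add_sdiff (μ := P) (f (φ k)) (S (φ k) b) (hS (φ k) k)
  rw [hsub] at h4
  refine (ENNReal.add_le_add_iff_left (ne_top_of_le_ne_top ENNReal.one_ne_top (hI (φ k) k))).1 ?_
  calc _ = I (φ k) b := h4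
    _ ≤ c + ε / 2 := h1.le
    _ ≤ I (φ k) k + (k : ℝ≥0∞)⁻¹ + ε / 2 := by gcongr; exact hφI k
    _ ≤ I (φ k) k + ε / 2 + ε / 2 := by gcongr
    _ = _ := by rw [add_assoc, ENNReal.add_halves]

/-- The subsequence splitting lemma: a bounded sequence in `L¹` has a subsequence that is
equi-integrable off pairwise disjoint sets. -/
theorem exists_subseq_splitting {f : ℕ → Ω → ℝ≥0∞} (hf : ∀ n, Measurable (f n))
    (hbd : ∀ n, ∫⁻ ω, f n ω ∂P ≤ 1) :
    ∃ φ : ℕ → ℕ, StrictMono φ ∧ ∃ A : ℕ → Set Ω, (∀ k, MeasurableSet (A k)) ∧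
      (∀ i j, i < j → Disjoint (A i) (A j)) ∧ ∀ ε : ℝ≥0∞, 0 < ε → ∃ δ : ℝ≥0∞, 0 < δ ∧
        ∀ k E, P E ≤ δ → ∫⁻ ω in E \ A k, f (φ k) ω ∂P ≤ ε := by
  obtain ⟨φ, hφ, hmid⟩ := exists_subseq_middle_small hf hbd
  set A₀ : ℕ → Set Ω := fun k => {ω | (k : ℝ≥0∞) < f (φ k) ω}
  have hA₀ : ∀ k, MeasurableSet (A₀ k) := fun k => measurableSet_lt measurable_const (hf _)
  have hfin : ∀ n, ∫⁻ ω, f n ω ∂P ≠ ∞ := fun n => ne_top_of_le_ne_top ENNReal.one_ne_top (hbd n)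
  have hPA : Tendsto (P ∘ A₀) atTop (𝓝 0) := by
    refine tendsto_of_tendsto_of_tendsto_of_le_of_le' tendsto_const_nhds
      ENNReal.tendsto_inv_nat_nhds_zero (Eventually.of_forall fun _ => bot_le) ?_
    filter_upwards [eventually_gt_atTop 0] with k hk
    have h0 : (k : ℝ≥0∞) ≠ 0 := by exact_mod_cast hk.ne'
    calc P (A₀ k) ≤ P {ω | (k : ℝ≥0∞) ≤ f (φ k) ω} := 
        measure_mono fun ω (hω : (k : ℝ≥0∞) < f (φ k) ω) => show (k : ℝ≥0∞) ≤ f (φ k) ω from hω.le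
      _ ≤ (∫⁻ ω, f (φ k) ω ∂P) / k :=
        meas_ge_le_lintegral_div (hf _).aemeasurable h0 (ENNReal.natCast_ne_top k)
      _ ≤ 1 / k := by gcongr; exact hbd _
      _ = _ := one_div _
  obtain ⟨ψ, hψ, hthin⟩ := exists_strictMono_forall_lt
    (Q := fun t i j => ∫⁻ ω in A₀ j, f (φ i) ω ∂P ≤ 2⁻¹ ^ t) (fun t i => by
      have h := tendsto_setLIntegral_zero (hfin (φ i)) hPA
      filter_upwards [h.eventually (gt_mem_nhds (ENNReal.pow_pos (by simp) t :
        (0 : ℝ≥0∞) < 2⁻¹ ^ t))] with j hj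
      exact hj.le)
  -- The level sets `A₀` become disjoint once the later ones, where the `i`-th term has little mass,
  -- are removed.
  set U : ℕ → Set Ω := fun i => ⋃ j, A₀ (ψ (i + 1 + j))
  have hU : ∀ i, ∫⁻ ω in U i, f (φ (ψ i)) ω ∂P ≤ 2⁻¹ ^ i := by
    intro i
    calc _ ≤ ∑' j, ∫⁻ ω in A₀ (ψ (i + 1 + j)), f (φ (ψ i)) ω ∂P := lintegral_iUnion_le _ _
      _ ≤ ∑' j, 2⁻¹ ^ (i + 1 + j) := ENNReal.tsum_le_tsum fun j => hthin _ _ (by omega)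
      _ = 2⁻¹ ^ i := by
        simp_rw [pow_add _ (i + 1)]
        rw [ENNReal.tsum_mul_left, ENNReal.tsum_geometric, ENNReal.one_sub_inv_two, inv_inv,
          pow_succ, mul_assoc, ENNReal.inv_mul_cancel (by simp) (by simp), mul_one]
  refine ⟨φ ∘ ψ, hφ.comp hψ, fun i => A₀ (ψ i) \ U i,
    fun i => (hA₀ _).diff (MeasurableSet.iUnion fun j => hA₀ _), ?_, ?_⟩
  · intro i j hij
    refine Set.disjoint_left.2 fun ω hi hj => hi.2 (Set.mem_iUnion.2 ⟨j - (i + 1), ?_⟩)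
    rw [Nat.add_sub_cancel' (Nat.succ_le_of_lt hij)]
    exact hj.1
  · intro ε hε
    have hε4 : 0 < ε / 4 := ENNReal.div_pos hε.ne' (by simp)
    have hε2 : 0 < ε / 2 := ENNReal.half_pos hε.ne'
    obtain ⟨b, hb⟩ := hmid (ε / 4) hε4
    have hpow : Tendsto (fun i : ℕ => (2⁻¹ : ℝ≥0∞) ^ i) atTop (𝓝 0) :=
      ENNReal.tendsto_pow_atTop_nhds_zero_of_lt_one (by simp)
    obtain ⟨K, hK⟩ := eventually_atTop.1 ((hψ.tendsto_atTop.eventually hb).and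
      (hpow.eventually (gt_mem_nhds hε4)))
    obtain ⟨δ₁, hδ₁, hδ₁'⟩ := ENNReal.exists_nnreal_pos_mul_lt (ENNReal.natCast_ne_top b) hε2.ne'
    choose δ' hδ' hδ'' using fun i =>
      exists_pos_setLIntegral_lt_of_measure_lt (hfin (φ (ψ i))) hε.ne'
    obtain ⟨δ, hδ0, hδ⟩ := exists_between (show 0 < min (δ₁ : ℝ≥0∞) ((Finset.range K).inf δ') from
      lt_min (by exact_mod_cast hδ₁)
        ((Finset.lt_inf_iff (by simp)).2 fun i _ => hδ' i))
    refine ⟨δ, hδ0, fun k E hE => ?_⟩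
    rcases lt_or_ge k K with hk | hk
    · refine (hδ'' k _ (lt_of_le_of_lt ((measure_mono Set.sdiff_subset).trans hE) ?_)).le
      exact hδ.trans_le ((min_le_right _ _).trans (Finset.inf_le (Finset.mem_range.2 hk)))
    · obtain ⟨h1, h2⟩ := hK k hk
      set g := f (φ (ψ k))
      set S : Set Ω := {ω | (b : ℝ≥0∞) < g ω}
      have hsub : E \ (A₀ (ψ k) \ U k) ⊆ (S \ A₀ (ψ k)) ∪ (E ∩ Sᶜ) ∪ U k := by
        intro ω hω
        by_cases hu : ω ∈ U k
        · exact Or.inr hu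
        · refine Or.inl ?_
          by_cases hs : ω ∈ S
          · exact Or.inl ⟨hs, fun ha => hω.2 ⟨ha, hu⟩⟩
          · exact Or.inr ⟨hω.1, hs⟩
      have h3 : ∫⁻ ω in E ∩ Sᶜ, g ω ∂P ≤ ε / 2 := by
        calc _ ≤ ∫⁻ ω in E ∩ Sᶜ, (b : ℝ≥0∞) ∂P := by
              refine setLIntegral_mono measurable_const fun ω hω => not_lt.1 hω.2
          _ = b * P (E ∩ Sᶜ) := setLIntegral_const _ _
          _ ≤ b * δ₁ := by
              gcongr
              exact (measure_mono Set.inter_subset_left).trans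
                (hE.trans (hδ.le.trans (min_le_left _ _)))
          _ ≤ _ := by rw [mul_comm]; exact hδ₁'.le
      calc _ ≤ ∫⁻ ω in (S \ A₀ (ψ k)) ∪ (E ∩ Sᶜ) ∪ U k, g ω ∂P := lintegral_mono_set hsub
        _ ≤ ∫⁻ ω in S \ A₀ (ψ k), g ω ∂P + ∫⁻ ω in E ∩ Sᶜ, g ω ∂P + ∫⁻ ω in U k, g ω ∂P :=
          (lintegral_union_le _ _ _).trans (by gcongr; exact lintegral_union_le _ _ _)
        _ ≤ ε / 4 + ε / 2 + ε / 4 := by gcongr; exact (hU k).trans h2.le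
        _ = ε := by
          have : ε / 4 + ε / 4 = ε / 2 := by
            rw [ENNReal.div_add_div_same, ← two_mul, show (4 : ℝ≥0∞) = 2 * 2 by norm_num,
              ENNReal.mul_div_mul_left _ _ (by simp) (by simp)]
          rw [add_right_comm, this, ENNReal.add_halves]

end

/-! ### The modular along means -/

section

open scoped ENNReal

variable {Ω : Type*} [MeasurableSpace Ω] {P : Measure Ω}

/-- The part of `Ψ` above the level `Ψ b`. It is convex and even like `Ψ`, differs from it by a bounded
amount, and vanishes on `[-b, b]`, so it ignores regions where its argument is small. -/
noncomputable def posPartSub (Ψ : ℝ → ℝ) (b y : ℝ) : ℝ := max (Ψ y - Ψ b) 0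

namespace IsYoungFunction

variable {Ψ : ℝ → ℝ} {b : ℝ}

theorem convexOn_posPartSub (h : IsYoungFunction Ψ) (b : ℝ) :
    ConvexOn ℝ Set.univ (posPartSub Ψ b) :=
  (h.convexOn.sub (concaveOn_const (Ψ b) convex_univ)).sup (convexOn_const 0 convex_univ)

theorem posPartSub_le_of_abs_le (h : IsYoungFunction Ψ) {x y : ℝ} (hxy : |x| ≤ |y|) :
    posPartSub Ψ b x ≤ posPartSub Ψ b y :=
  max_le_max_right _ (sub_le_sub_right (h.le_of_abs_le hxy) _)

theorem posPartSub_le (h : IsYoungFunction Ψ) (y : ℝ) : posPartSub Ψ b y ≤ Ψ y :=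
  max_le (by linarith [h.nonneg b]) (h.nonneg y)

theorem posPartSub_eq_zero (h : IsYoungFunction Ψ) {y : ℝ} (hy : |y| ≤ |b|) :
    posPartSub Ψ b y = 0 :=
  max_eq_right (sub_nonpos.2 (h.le_of_abs_le hy))

theorem measurable_ofReal_comp (h : IsYoungFunction Ψ) {Y : Ω → ℝ} (hY : Measurable Y) :
    Measurable fun ω => ENNReal.ofReal (Ψ (Y ω)) :=
  (h.continuous.measurable.comp hY).ennreal_ofReal

theorem measurable_ofReal_posPartSub (h : IsYoungFunction Ψ) {Y : Ω → ℝ} (hY : Measurable Y) :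
    Measurable fun ω => ENNReal.ofReal (posPartSub Ψ b (Y ω)) :=
  (((h.continuous.measurable.comp hY).sub_const _).max measurable_const).ennreal_ofReal

/-- By convexity, a bound on the modulars of the terms passes to the means. The measure `P` is
arbitrary, so that integrals over subsets are covered. -/
theorem lintegral_avg_le (h : IsYoungFunction Ψ) {Y : ℕ → Ω → ℝ} (hY : ∀ n, Measurable (Y n))
    {C : ℝ≥0∞} (hC : ∀ n, ∫⁻ ω, ENNReal.ofReal (Ψ (Y n ω)) ∂P ≤ C) {N : ℕ} (hN : 0 < N) :
    ∫⁻ ω, ENNReal.ofReal (Ψ (avg Y N ω)) ∂P ≤ C := by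
  have hN0 : (N : ℝ≥0∞) ≠ 0 := by exact_mod_cast hN.ne'
  calc _ ≤ ∫⁻ ω, (N : ℝ≥0∞)⁻¹ * ∑ i ∈ Finset.range N, ENNReal.ofReal (Ψ (Y i ω)) ∂P := by
        refine lintegral_mono fun ω => ?_
        rw [avg_apply]
        refine (ENNReal.ofReal_le_ofReal (h.convexOn.map_avg_le _ hN)).trans_eq ?_
        rw [avg, smul_eq_mul, ENNReal.ofReal_mul (by positivity),
          ENNReal.ofReal_inv_of_pos (by positivity), ENNReal.ofReal_natCast,
          ENNReal.ofReal_sum_of_nonneg fun i _ => h.nonneg _]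
    _ = (N : ℝ≥0∞)⁻¹ * ∑ i ∈ Finset.range N, ∫⁻ ω, ENNReal.ofReal (Ψ (Y i ω)) ∂P := by
        rw [lintegral_const_mul _
          (Finset.measurable_sum _ fun i _ => h.measurable_ofReal_comp (hY i)),
          lintegral_finsetSum _ fun i _ => h.measurable_ofReal_comp (hY i)]
    _ ≤ (N : ℝ≥0∞)⁻¹ * (N * C) := by
        gcongr
        refine (Finset.sum_le_sum fun i _ => hC i).trans_eq ?_
        simp
    _ = C := by
        rw [← mul_assoc, ENNReal.inv_mul_cancel hN0 (ENNReal.natCast_ne_top N), one_mul]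

theorem lintegral_le_of_tendsto_eLpNorm (h : IsYoungFunction Ψ) {Y : ℕ → Ω → ℝ}
    (hY : ∀ n, Measurable (Y n)) (hC : ∀ n, ∫⁻ ω, ENNReal.ofReal (Ψ (Y n ω)) ∂P ≤ 1)
    {X₀ : Ω → ℝ} (hX₀ : Measurable X₀)
    (hlim : Tendsto (fun N => eLpNorm (avg Y N - X₀) 1 P) atTop (𝓝 0)) :
    ∫⁻ ω, ENNReal.ofReal (Ψ (X₀ ω)) ∂P ≤ 1 := by
  obtain ⟨ns, hns, hae⟩ := (tendstoInMeasure_of_tendsto_eLpNorm one_ne_zero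
    (fun N => (measurable_avg hY N).aestronglyMeasurable) hX₀.aestronglyMeasurable
    hlim).exists_seq_tendsto_ae
  calc _ = ∫⁻ ω, liminf (fun l => ENNReal.ofReal (Ψ (avg Y (ns l) ω))) atTop ∂P := by
        refine lintegral_congr_ae ?_
        filter_upwards [hae] with ω hω
        exact (((ENNReal.continuous_ofReal.comp h.continuous).tendsto _).comp hω).liminf_eq.symm
    _ ≤ liminf (fun l => ∫⁻ ω, ENNReal.ofReal (Ψ (avg Y (ns l) ω)) ∂P) atTop :=
        lintegral_liminf_le fun l => h.measurable_ofReal_comp (measurable_avg hY _)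
    _ ≤ limsup (fun l => ∫⁻ ω, ENNReal.ofReal (Ψ (avg Y (ns l) ω)) ∂P) atTop := liminf_le_limsup
    _ ≤ 1 := by
        refine limsup_le_of_le (by isBoundedDefault) ?_
        filter_upwards [eventually_gt_atTop 0] with l hl
        exact h.lintegral_avg_le hY hC (hl.trans_le hns.le_apply)

/-- The equi-integrable part: where the mean is far from `X₀`, a set of small measure, convexity
bounds the modular of the mean by the equi-integrable modulars of the terms. -/
theorem tendsto_lintegral_posPartSub_avg_sub (h : IsYoungFunction Ψ) (hb : 0 < b)
    {Y : ℕ → Ω → ℝ} (hY : ∀ n, Measurable (Y n))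
    (hui : ∀ ε : ℝ≥0∞, 0 < ε → ∃ δ : ℝ≥0∞, 0 < δ ∧ ∀ n E, P E ≤ δ →
      ∫⁻ ω in E, ENNReal.ofReal (Ψ (Y n ω)) ∂P ≤ ε)
    {X₀ : Ω → ℝ} (hX₀ : Measurable X₀) (hX₀Ψ : ∫⁻ ω, ENNReal.ofReal (Ψ (X₀ ω)) ∂P ≠ ∞)
    (hlim : Tendsto (fun N => eLpNorm (avg Y N - X₀) 1 P) atTop (𝓝 0)) :
    Tendsto (fun N => ∫⁻ ω, ENNReal.ofReal (posPartSub Ψ b ((avg Y N ω - X₀ ω) / 2)) ∂P)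
      atTop (𝓝 0) := by
  have hmeas₀ : TendstoInMeasure P (fun N => avg Y N) atTop X₀ :=
    tendstoInMeasure_of_tendsto_eLpNorm one_ne_zero
      (fun N => (measurable_avg hY N).aestronglyMeasurable) hX₀.aestronglyMeasurable hlim
  have hmeas := tendstoInMeasure_iff_norm.1 hmeas₀ (2 * b) (by positivity)
  set E : ℕ → Set Ω := fun N => {ω | 2 * b ≤ ‖avg Y N ω - X₀ ω‖}
  have hE : ∀ N, MeasurableSet (E N) := fun N =>
    measurableSet_le measurable_const ((measurable_avg hY N).sub hX₀).norm
  have h2 := tendsto_setLIntegral_zero hX₀Ψ (s := E) hmeas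
  have h1 : Tendsto (fun N => ∫⁻ ω in E N, ENNReal.ofReal (Ψ (avg Y N ω)) ∂P) atTop (𝓝 0) := by
    rw [ENNReal.tendsto_nhds_zero]
    intro ε hε
    obtain ⟨δ, hδ, hδ'⟩ := hui ε hε
    filter_upwards [ENNReal.tendsto_nhds_zero.1 hmeas δ hδ, eventually_gt_atTop 0] with N hN hN0
    exact h.lintegral_avg_le (P := P.restrict (E N)) hY (fun n => hδ' n _ hN) hN0
  refine tendsto_of_tendsto_of_tendsto_of_le_of_le tendsto_const_nhds
    (by simpa using h1.add h2) (fun _ => bot_le) fun N => ?_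
  have hle : ∀ ω, ENNReal.ofReal (posPartSub Ψ b ((avg Y N ω - X₀ ω) / 2)) ≤
      (E N).indicator (fun ω => ENNReal.ofReal (Ψ (avg Y N ω)) + ENNReal.ofReal (Ψ (X₀ ω))) ω := by
    intro ω
    by_cases hω : ω ∈ E N
    · rw [Set.indicator_of_mem hω, ← ENNReal.ofReal_add (h.nonneg _) (h.nonneg _)]
      refine ENNReal.ofReal_le_ofReal ((h.posPartSub_le _).trans ?_)
      have := h.convexOn.2 (Set.mem_univ (avg Y N ω)) (Set.mem_univ (-X₀ ω))
        (by norm_num : (0 : ℝ) ≤ 1 / 2) (by norm_num : (0 : ℝ) ≤ 1 / 2) (by norm_num)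
      simp only [smul_eq_mul, h.even] at this
      rw [show (avg Y N ω - X₀ ω) / 2 = 1 / 2 * avg Y N ω + 1 / 2 * -X₀ ω by ring]
      linarith [h.nonneg (avg Y N ω), h.nonneg (X₀ ω)]
    · have hω' : ‖avg Y N ω - X₀ ω‖ < 2 * b := not_le.1 hω
      rw [Set.indicator_of_notMem hω, h.posPartSub_eq_zero, ENNReal.ofReal_zero]
      rw [abs_div, abs_two, abs_of_pos hb, div_le_iff₀ two_pos, ← Real.norm_eq_abs]
      linarith
  calc _ ≤ _ := lintegral_mono hle
    _ = _ := by
      rw [lintegral_indicator (hE N), lintegral_add_left (h.measurable_ofReal_comp (measurable_avg hY N))]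

end IsYoungFunction

theorem sum_indicator_of_disjoint {α : Type*} {A : ℕ → Set α}
    (hA : ∀ i j, i < j → Disjoint (A i) (A j)) (X : ℕ → α → ℝ) {i : ℕ} {ω : α} (hω : ω ∈ A i) (N : ℕ) :
    ∑ j ∈ Finset.range N, (A j).indicator (X j) ω = if i < N then X i ω else 0 := by
  have h0 : ∀ j, j ≠ i → (A j).indicator (X j) ω = 0 := fun j hj => by
    refine Set.indicator_of_notMem (fun hj' => ?_) _
    rcases hj.lt_or_gt with h | h
    · exact Set.disjoint_left.1 (hA _ _ h) hj' hω
    · exact Set.disjoint_left.1 (hA _ _ h) hω hj'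
  split_ifs with h
  · rw [Finset.sum_eq_single_of_mem i (Finset.mem_range.2 h) fun j _ hj => h0 j hj,
      Set.indicator_of_mem hω]
  · exact Finset.sum_eq_zero fun j hj => h0 j (by have := Finset.mem_range.1 hj; omega)

theorem tendsto_avg_indicator_of_disjoint {α : Type*} {A : ℕ → Set α}
    (hA : ∀ i j, i < j → Disjoint (A i) (A j)) (X : ℕ → α → ℝ) (ω : α) :
    Tendsto (fun N => avg (fun i => (A i).indicator (X i)) N ω) atTop (𝓝 0) := by
  simp only [avg_apply]
  simp only [avg, smul_eq_mul]
  by_cases h : ∃ i, ω ∈ A i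
  · obtain ⟨i, hi⟩ := h
    have := (tendsto_inv_atTop_nhds_zero_nat (𝕜 := ℝ)).mul_const (X i ω)
    rw [zero_mul] at this
    refine this.congr' ?_
    filter_upwards [eventually_gt_atTop i] with N hN
    rw [sum_indicator_of_disjoint hA X hi, if_pos hN]
  · push Not at h
    simp [Set.indicator_of_notMem (h _)]

/-- The part carried by disjoint sets: its mean at a point is a single value `y / N`, for which
`Ψ (y / N)` is of smaller order than `Ψ y / N`. -/
theorem IsYoungFunction.tendsto_lintegral_posPartSub_avg_indicator {Ψ : ℝ → ℝ} {b : ℝ}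
    (h : IsYoungFunction Ψ)
    (hgrow : ∀ ε : ℝ, 0 < ε → ∀ᶠ N : ℕ in atTop, ∀ y, b ≤ |y| → N * Ψ y ≤ ε * Ψ (N * y))
    {A : ℕ → Set Ω} (hA : ∀ i j, i < j → Disjoint (A i) (A j)) {X : ℕ → Ω → ℝ}
    (hX : ∀ n, Measurable (X n)) (hC : ∀ n, ∫⁻ ω, ENNReal.ofReal (Ψ (X n ω)) ∂P ≤ 1) :
    Tendsto (fun N => ∫⁻ ω, ENNReal.ofReal (posPartSub Ψ b
      (avg (fun i => (A i).indicator (X i)) N ω)) ∂P) atTop (𝓝 0) := by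
  have key : ∀ ε : ℝ, 0 < ε → ∀ᶠ N : ℕ in atTop, ∫⁻ ω, ENNReal.ofReal (posPartSub Ψ b
      (avg (fun i => (A i).indicator (X i)) N ω)) ∂P ≤ ENNReal.ofReal ε := by
    intro ε hε
    filter_upwards [hgrow ε hε, eventually_gt_atTop 0] with N hN hN0
    have hN' : (0 : ℝ) < N := by exact_mod_cast hN0
    have hpt : ∀ ω, posPartSub Ψ b (avg (fun i => (A i).indicator (X i)) N ω) ≤
        ε / N * ∑ i ∈ Finset.range N, Ψ (X i ω) := by
      intro ω
      have hnn : 0 ≤ ε / N * ∑ i ∈ Finset.range N, Ψ (X i ω) :=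
        mul_nonneg (by positivity) (Finset.sum_nonneg fun i _ => h.nonneg _)
      rw [avg_apply, avg, smul_eq_mul]
      by_cases hex : ∃ i, ω ∈ A i
      · obtain ⟨i, hi⟩ := hex
        rw [sum_indicator_of_disjoint hA X hi]
        split_ifs with hiN
        · rcases le_total |(N : ℝ)⁻¹ * X i ω| b with hy | hy
          · rw [h.posPartSub_eq_zero (hy.trans (le_abs_self b))]
            exact hnn
          · have h1 := hN _ hy
            rw [mul_inv_cancel_left₀ hN'.ne'] at h1
            calc _ ≤ Ψ ((N : ℝ)⁻¹ * X i ω) := h.posPartSub_le _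
              _ ≤ ε / N * Ψ (X i ω) := by
                rw [div_mul_eq_mul_div, le_div_iff₀ hN']; linarith
              _ ≤ _ := by
                gcongr
                exact Finset.single_le_sum (f := fun i => Ψ (X i ω)) (fun i _ => h.nonneg _)
                  (Finset.mem_range.2 hiN)
        · rw [mul_zero, h.posPartSub_eq_zero (by simp)]
          exact hnn
      · push Not at hex
        rw [Finset.sum_eq_zero fun i _ => Set.indicator_of_notMem (hex i) _, mul_zero,
          h.posPartSub_eq_zero (by simp)]
        exact hnn
    calc _ ≤ ∫⁻ ω, ENNReal.ofReal (ε / N) * ∑ i ∈ Finset.range N, ENNReal.ofReal (Ψ (X i ω)) ∂P := by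
          refine lintegral_mono fun ω => (ENNReal.ofReal_le_ofReal (hpt ω)).trans_eq ?_
          rw [ENNReal.ofReal_mul (by positivity),
            ENNReal.ofReal_sum_of_nonneg fun i _ => h.nonneg _]
      _ = ENNReal.ofReal (ε / N) * ∑ i ∈ Finset.range N,
          ∫⁻ ω, ENNReal.ofReal (Ψ (X i ω)) ∂P := by
        rw [lintegral_const_mul _
          (Finset.measurable_sum _ fun i _ => h.measurable_ofReal_comp (hX i)),
          lintegral_finsetSum _ fun i _ => h.measurable_ofReal_comp (hX i)]
      _ ≤ ENNReal.ofReal (ε / N) * ∑ i ∈ Finset.range N, 1 := by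
        gcongr with i _
        exact hC i
      _ = ENNReal.ofReal ε := by
        rw [Finset.sum_const, Finset.card_range, nsmul_one, ← ENNReal.ofReal_natCast,
          ← ENNReal.ofReal_mul (by positivity), div_mul_cancel₀ _ hN'.ne']
  rw [ENNReal.tendsto_nhds_zero]
  intro ε hε
  obtain ⟨r, hr0, hr⟩ := ENNReal.lt_iff_exists_nnreal_btwn.1 hε
  filter_upwards [key r (by exact_mod_cast hr0)] with N hN
  exact hN.trans (by simpa using hr.le)

/-- A sequence with bounded modular has a subsequence such that the means of all further
subsequences approach the same `X₀`, almost everywhere along some subsequence of them and in the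
modular of the part of `Ψ` above `Ψ b`. -/
theorem IsYoungFunction.exists_subseq_avg {Ψ : ℝ → ℝ} {b : ℝ} [IsProbabilityMeasure P]
    (h : IsYoungFunction Ψ) (hb : 0 < b)
    (hgrow : ∀ ε : ℝ, 0 < ε → ∀ᶠ N : ℕ in atTop, ∀ y, b ≤ |y| → N * Ψ y ≤ ε * Ψ (N * y))
    {X : ℕ → Ω → ℝ}
    (hX : ∀ n, Measurable (X n)) (hC : ∀ n, ∫⁻ ω, ENNReal.ofReal (Ψ (X n ω)) ∂P ≤ 1) :
    ∃ n : ℕ → ℕ, StrictMono n ∧ ∃ X₀ : Ω → ℝ, Measurable X₀ ∧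
      ∫⁻ ω, ENNReal.ofReal (Ψ (X₀ ω)) ∂P ≤ 1 ∧ ∀ k : ℕ → ℕ, StrictMono k →
        (∃ ns : ℕ → ℕ, StrictMono ns ∧ ∀ᵐ ω ∂P,
          Tendsto (fun l => avg (fun i => X (n (k i))) (ns l) ω) atTop (𝓝 (X₀ ω))) ∧
        Tendsto (fun N => ∫⁻ ω, ENNReal.ofReal (posPartSub Ψ b
          ((avg (fun i => X (n (k i))) N ω - X₀ ω) / 4)) ∂P) atTop (𝓝 0) := by
  obtain ⟨φ₁, hφ₁, A, hAm, hA, hui⟩ := exists_subseq_splitting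
    (fun n => h.measurable_ofReal_comp (hX n)) hC
  set Y : ℕ → Ω → ℝ := fun i => (A i)ᶜ.indicator (X (φ₁ i))
  have hY : ∀ n, Measurable (Y n) := fun n => (hX _).indicator (hAm n).compl
  have hYeq : ∀ n, (fun ω => ENNReal.ofReal (Ψ (Y n ω))) =
      (A n)ᶜ.indicator fun ω => ENNReal.ofReal (Ψ (X (φ₁ n) ω)) := by
    intro n
    ext ω
    by_cases hω : ω ∈ A n <;> simp [Y, hω, h.map_zero]
  have hYC : ∀ n, ∫⁻ ω, ENNReal.ofReal (Ψ (Y n ω)) ∂P ≤ 1 := fun n => by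
    rw [hYeq]
    exact (lintegral_indicator_le _ _).trans ((setLIntegral_le_lintegral _ _).trans (hC _))
  obtain ⟨φ₂, hφ₂, X₀, hX₀, hlim⟩ := h.exists_subseq_avg_tendsto_eLpNorm hY hYC
  have hX₀C := h.lintegral_le_of_tendsto_eLpNorm (fun i => hY (φ₂ i)) (fun i => hYC (φ₂ i)) hX₀
    (hlim id strictMono_id)
  refine ⟨φ₁ ∘ φ₂, hφ₁.comp hφ₂, X₀, hX₀, hX₀C, fun k hk => ?_⟩
  set κ : ℕ → ℕ := fun i => φ₂ (k i)
  have hκ : StrictMono κ := hφ₂.comp hk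
  have hAκ : ∀ i j, i < j → Disjoint (A (κ i)) (A (κ j)) := fun i j hij => hA _ _ (hκ hij)
  have hdecomp : ∀ N ω, avg (fun i => X ((φ₁ ∘ φ₂) (k i))) N ω =
      avg (fun i => Y (κ i)) N ω +
        avg (fun i => (A (κ i)).indicator (X (φ₁ (κ i)))) N ω := by
    intro N ω
    simp only [avg_apply]
    simp only [avg]
    rw [← smul_add, ← Finset.sum_add_distrib]
    congr 1
    refine Finset.sum_congr rfl fun i _ => ?_
    simp only [Y, κ, Function.comp]
    exact (Set.indicator_compl_add_self_apply _ _ _).symm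
  constructor
  · obtain ⟨ns, hns, hae⟩ := (tendstoInMeasure_of_tendsto_eLpNorm one_ne_zero
      (fun N => (measurable_avg (fun i => hY (κ i)) N).aestronglyMeasurable)
      hX₀.aestronglyMeasurable (hlim k hk)).exists_seq_tendsto_ae
    refine ⟨ns, hns, ?_⟩
    filter_upwards [hae] with ω hω
    simp only [hdecomp]
    simpa using hω.add ((tendsto_avg_indicator_of_disjoint hAκ (fun i => X (φ₁ (κ i))) ω).comp
      hns.tendsto_atTop)
  · have h1 := h.tendsto_lintegral_posPartSub_avg_sub hb (fun i => hY (κ i)) (fun ε hε => by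
      obtain ⟨δ, hδ, hδ'⟩ := hui ε hε
      refine ⟨δ, hδ, fun n E hE => ?_⟩
      rw [hYeq, setLIntegral_indicator (hAm _).compl, Set.inter_comm, ← Set.sdiff_eq]
      exact hδ' _ _ hE) hX₀ (ne_top_of_le_ne_top ENNReal.one_ne_top hX₀C) (hlim k hk)
    have h2 := h.tendsto_lintegral_posPartSub_avg_indicator (P := P) hgrow hAκ
      (fun i => hX (φ₁ (κ i))) (fun i => hC _)
    refine tendsto_of_tendsto_of_tendsto_of_le_of_le tendsto_const_nhds
      (by simpa using h1.add h2) (fun _ => bot_le) fun N => ?_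
    change _ ≤ _ + _
    have hm : Measurable fun ω => (avg (fun i => Y (κ i)) N ω - X₀ ω) / 2 :=
      ((measurable_avg (fun i => hY (κ i)) N).sub hX₀).div_const 2
    rw [← lintegral_add_left (h.measurable_ofReal_posPartSub hm)]
    refine lintegral_mono fun ω => ?_
    have hG0 : ∀ y, 0 ≤ posPartSub Ψ b y := fun y => le_max_right _ _
    rw [← ENNReal.ofReal_add (hG0 _) (hG0 _)]
    refine ENNReal.ofReal_le_ofReal ?_
    rw [hdecomp]
    set u := avg (fun i => Y (κ i)) N ω
    set v := avg (fun i => (A (κ i)).indicator (X (φ₁ (κ i)))) N ω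
    have h3 := (h.convexOn_posPartSub b).2 (Set.mem_univ ((u - X₀ ω) / 2)) (Set.mem_univ (v / 2))
      (by norm_num : (0 : ℝ) ≤ 1 / 2) (by norm_num : (0 : ℝ) ≤ 1 / 2) (by norm_num)
    have h4 : posPartSub Ψ b (v / 2) ≤ posPartSub Ψ b v := h.posPartSub_le_of_abs_le (by
      rw [abs_div, abs_two]; linarith [abs_nonneg v])
    simp only [smul_eq_mul] at h3
    rw [show (u + v - X₀ ω) / 4 = 1 / 2 * ((u - X₀ ω) / 2) + 1 / 2 * (v / 2) by ring]
    linarith [hG0 ((u - X₀ ω) / 2), hG0 v]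

end

/-! ### Passage to the supremum and to the Orlicz space -/

section

open scoped ENNReal

variable {Ω : Type*} [MeasurableSpace Ω] {P : Measure Ω}

/-- Rapid convergence in the modular makes the supremum of the sequence an element of the Orlicz
space. -/
theorem IsYoungFunction.exists_lintegral_iSup_le {Ψ : ℝ → ℝ} {b : ℝ} [IsProbabilityMeasure P]
    (h : IsYoungFunction Ψ) {M : ℕ → Ω → ℝ} (hM : ∀ l, Measurable (M l)) {X₀ : Ω → ℝ}
    (hX₀ : Measurable X₀) (hX₀C : ∫⁻ ω, ENNReal.ofReal (Ψ (X₀ ω)) ∂P ≤ 1)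
    (hlim : ∀ᵐ ω ∂P, Tendsto (fun l => M l ω) atTop (𝓝 (X₀ ω)))
    (hG : ∀ l, ∫⁻ ω, ENNReal.ofReal (posPartSub Ψ b ((M l ω - X₀ ω) / 4)) ∂P ≤ 2⁻¹ ^ l) :
    ∃ t : ℝ, 0 < t ∧ ∫⁻ ω, ENNReal.ofReal (Ψ (t * ⨆ l, |M l ω|)) ∂P ≤ 1 := by
  set R : Ω → ℝ≥0∞ := fun ω => (∑' l, ENNReal.ofReal (posPartSub Ψ b ((M l ω - X₀ ω) / 4))) +
    (ENNReal.ofReal (Ψ b) + ENNReal.ofReal (Ψ (X₀ ω)))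
  have hGm : ∀ l, Measurable fun ω => ENNReal.ofReal (posPartSub Ψ b ((M l ω - X₀ ω) / 4)) :=
    fun l => h.measurable_ofReal_posPartSub (((hM l).sub hX₀).div_const 4)
  set C : ℝ := 3 + Ψ b
  have hC1 : 1 ≤ C := by linarith [h.nonneg b]
  have hRint : ∫⁻ ω, R ω ∂P ≤ ENNReal.ofReal C := by
    rw [lintegral_add_left (Measurable.tsum hGm), lintegral_add_left measurable_const,
      lintegral_tsum fun l => (hGm l).aemeasurable, lintegral_const, measure_univ, mul_one]
    have h1 : ∑' l, ∫⁻ ω, ENNReal.ofReal (posPartSub Ψ b ((M l ω - X₀ ω) / 4)) ∂P ≤ 2 := by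
      refine (ENNReal.tsum_le_tsum hG).trans_eq ?_
      rw [ENNReal.tsum_geometric, ENNReal.one_sub_inv_two, inv_inv]
    calc _ ≤ 2 + (ENNReal.ofReal (Ψ b) + 1) := by gcongr
      _ = ENNReal.ofReal C := by
        rw [show C = 2 + (Ψ b + 1) by simp only [C]; ring, ENNReal.ofReal_add (by norm_num)
          (by linarith [h.nonneg b]), ENNReal.ofReal_add (h.nonneg b) (by norm_num)]
        simp
  have hpt : ∀ᵐ ω ∂P, ENNReal.ofReal (Ψ ((⨆ l, |M l ω|) / 8)) ≤ R ω := by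
    filter_upwards [hlim] with ω hω
    have hl : ∀ l, ENNReal.ofReal (Ψ (|M l ω| / 8)) ≤ R ω := by
      intro l
      have h1 := h.convexOn.2 (Set.mem_univ ((M l ω - X₀ ω) / 4)) (Set.mem_univ (X₀ ω / 4))
        (by norm_num : (0 : ℝ) ≤ 1 / 2) (by norm_num : (0 : ℝ) ≤ 1 / 2) (by norm_num)
      simp only [smul_eq_mul] at h1
      rw [show 1 / 2 * ((M l ω - X₀ ω) / 4) + 1 / 2 * (X₀ ω / 4) = M l ω / 8 by ring] at h1
      have h2 : Ψ (X₀ ω / 4) ≤ Ψ (X₀ ω) := h.le_of_abs_le (by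
        rw [abs_div, abs_of_pos (by norm_num : (0 : ℝ) < 4)]
        linarith [abs_nonneg (X₀ ω)])
      have h3 : Ψ ((M l ω - X₀ ω) / 4) ≤ posPartSub Ψ b ((M l ω - X₀ ω) / 4) + Ψ b := by
        linarith [le_max_left (Ψ ((M l ω - X₀ ω) / 4) - Ψ b) 0,
          show posPartSub Ψ b ((M l ω - X₀ ω) / 4) =
            max (Ψ ((M l ω - X₀ ω) / 4) - Ψ b) 0 from rfl]
      have h4 : 0 ≤ posPartSub Ψ b ((M l ω - X₀ ω) / 4) := le_max_right _ _
      have h5 : Ψ (|M l ω| / 8) ≤ Ψ (M l ω / 8) := h.le_of_abs_le (by simp [abs_div])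
      calc _ ≤ ENNReal.ofReal (posPartSub Ψ b ((M l ω - X₀ ω) / 4) + (Ψ b + Ψ (X₀ ω))) :=
            ENNReal.ofReal_le_ofReal (by linarith [h.nonneg b, h.nonneg (X₀ ω)])
        _ ≤ R ω := by
          rw [ENNReal.ofReal_add h4 (add_nonneg (h.nonneg _) (h.nonneg _)),
            ENNReal.ofReal_add (h.nonneg _) (h.nonneg _)]
          exact add_le_add (ENNReal.le_tsum (f := fun l =>
            ENNReal.ofReal (posPartSub Ψ b ((M l ω - X₀ ω) / 4))) l) le_rfl
    -- The supremum need not be attained, but it lies in the closure of the values.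
    have hclosed : IsClosed {x : ℝ | ENNReal.ofReal (Ψ (x / 8)) ≤ R ω} :=
      isClosed_le (ENNReal.continuous_ofReal.comp (h.continuous.comp (continuous_id.div_const 8)))
        continuous_const
    have hmem := csSup_mem_closure (Set.range_nonempty fun l => |M l ω|) hω.abs.bddAbove_range
    exact (hclosed.closure_subset_iff.2 (Set.range_subset_iff.2 hl)) hmem
  have hCpos : 0 < C := by linarith
  refine ⟨C⁻¹ / 8, by positivity, ?_⟩
  calc _ ≤ ∫⁻ ω, ENNReal.ofReal C⁻¹ * ENNReal.ofReal (Ψ ((⨆ l, |M l ω|) / 8)) ∂P := by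
        refine lintegral_mono fun ω => ?_
        rw [← ENNReal.ofReal_mul (by positivity)]
        refine ENNReal.ofReal_le_ofReal ?_
        rw [show C⁻¹ / 8 * ⨆ l, |M l ω| = C⁻¹ * ((⨆ l, |M l ω|) / 8) by ring]
        exact h.map_mul_le (by positivity) (inv_le_one_of_one_le₀ hC1) _
    _ = ENNReal.ofReal C⁻¹ * ∫⁻ ω, ENNReal.ofReal (Ψ ((⨆ l, |M l ω|) / 8)) ∂P :=
        lintegral_const_mul' _ _ ENNReal.ofReal_ne_top
    _ ≤ ENNReal.ofReal C⁻¹ * ENNReal.ofReal C := by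
        gcongr
        exact (lintegral_mono_ae hpt).trans hRint
    _ = 1 := by
        rw [← ENNReal.ofReal_mul (by positivity), inv_mul_cancel₀ hCpos.ne', ENNReal.ofReal_one]

theorem IsYoungFunction.inv_smul_mem_orliczUnitBall {Ψ : ℝ → ℝ} (h : IsYoungFunction Ψ)
    {ξ : Ω →ₘ[P] ℝ} (hξ : ξ ∈ orliczSpace Ψ P) {r : ℝ} (hr : orliczNorm Ψ P ξ < r) :
    r⁻¹ • ξ ∈ orliczUnitBall Ψ P := by
  obtain ⟨s, ⟨hs0, hs⟩, hsr⟩ := exists_lt_of_csInf_lt hξ hr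
  refine le_trans (lintegral_mono_ae ?_) hs
  filter_upwards [AEEqFun.coeFn_smul r⁻¹ ξ, AEEqFun.coeFn_smul s⁻¹ ξ] with ω h1 h2
  rw [h1, h2]
  refine ENNReal.ofReal_le_ofReal (h.le_of_abs_le ?_)
  simp only [Pi.smul_apply, smul_eq_mul, abs_mul, abs_inv, abs_of_pos hs0,
    abs_of_pos (hs0.trans hsr)]
  gcongr

end

theorem theorem3p6 {Ω : Type*} [MeasurableSpace Ω] (P : Measure Ω) [IsProbabilityMeasure P]
    (Φ : ℝ → ℝ) (hΦ : IsYoungFunction Φ) (hΔ : SatisfiesDeltaTwo Φ)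
    (ξ : ℕ → Ω →ₘ[P] ℝ) (hmem : ∀ n, ξ n ∈ orliczSpace (youngConjugate Φ) P)
    (hbdd : ∃ C : ℝ, ∀ n, orliczNorm (youngConjugate Φ) P (ξ n) ≤ C) :
    ∃ n : ℕ → ℕ, StrictMono n ∧ ∃ ξ₀ ∈ orliczSpace (youngConjugate Φ) P,
      ∀ k : ℕ → ℕ, StrictMono k →
        ∃ N : ℕ → ℕ, StrictMono N ∧ (∀ l, 1 ≤ N l) ∧
          (∃ η ∈ orliczSpace (youngConjugate Φ) P,
            IsLUB (Set.range fun l => |cesaroMean (fun i => ξ (n (k i))) (N l)|) η) ∧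
          ∀ᵐ ω ∂P, Tendsto (fun l => cesaroMean (fun i => ξ (n (k i))) (N l) ω)
            atTop (𝓝 (ξ₀ ω)) := by
  set Ψ := youngConjugate Φ
  have hΨ : IsYoungFunction Ψ := hΦ.conjugate
  obtain ⟨C, hC⟩ := hbdd
  obtain ⟨K, hK, b₀, hb₀, hgrow₀⟩ := hΔ.conjugate_growth hΦ
  set b := max b₀ 1
  have hb : 0 < b := lt_max_of_lt_right one_pos
  have hgrow : ∀ ε : ℝ, 0 < ε → ∀ᶠ N : ℕ in atTop, ∀ y, b ≤ |y| → N * Ψ y ≤ ε * Ψ (N * y) :=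
    fun ε hε => hΨ.eventually_mul_div_le hK hb.le
      (fun y hy => hgrow₀ y ((le_max_left _ _).trans hy)) hε
  set r : ℝ := |C| + 1
  have hr : 0 < r := by positivity
  set X : ℕ → Ω → ℝ := fun n => ⇑(r⁻¹ • ξ n)
  have hX : ∀ n, Measurable (X n) := fun n => AEEqFun.measurable _
  have hball : ∀ n, ∫⁻ ω, ENNReal.ofReal (Ψ (X n ω)) ∂P ≤ 1 := fun n =>
    hΨ.inv_smul_mem_orliczUnitBall (hmem n) (by linarith [hC n, le_abs_self C])
  obtain ⟨n, hn, X₀, hX₀, hX₀C, hsub⟩ := hΨ.exists_subseq_avg hb hgrow hX hball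
  have hm₀ : Measurable fun ω => r * X₀ ω := hX₀.const_mul r
  refine ⟨n, hn, AEEqFun.mk _ hm₀.aestronglyMeasurable, ⟨r, hr, ?_⟩, fun k hk => ?_⟩
  · refine le_trans (lintegral_mono_ae ?_) hX₀C
    filter_upwards [AEEqFun.coeFn_smul r⁻¹ (AEEqFun.mk _ hm₀.aestronglyMeasurable),
      AEEqFun.coeFn_mk _ hm₀.aestronglyMeasurable] with ω h1 h2
    rw [h1, Pi.smul_apply, h2, smul_eq_mul, inv_mul_cancel_left₀ hr.ne']
  obtain ⟨⟨ns, hns, hae⟩, hG⟩ := hsub k hk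
  obtain ⟨θ, hθ, hθG⟩ := extraction_forall_of_eventually'
    (P := fun l i => 1 ≤ ns i ∧ ∫⁻ ω, ENNReal.ofReal (posPartSub Ψ b
      ((avg (fun i => X (n (k i))) (ns i) ω - X₀ ω) / 4)) ∂P ≤ 2⁻¹ ^ l) (fun l => by
        refine eventually_atTop.1 ((hns.tendsto_atTop.eventually_ge_atTop 1).and ?_)
        exact hns.tendsto_atTop.eventually (ENNReal.tendsto_nhds_zero.1 hG _
          (ENNReal.pow_pos (by simp) l)))
  set M : ℕ → Ω → ℝ := fun l => avg (fun i => X (n (k i))) (ns (θ l))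
  have hM : ∀ l, Measurable (M l) := fun l => measurable_avg (fun i => hX _) _
  have hlim : ∀ᵐ ω ∂P, Tendsto (fun l => M l ω) atTop (𝓝 (X₀ ω)) := by
    filter_upwards [hae] with ω hω
    exact hω.comp hθ.tendsto_atTop
  obtain ⟨t, ht, htint⟩ := hΨ.exists_lintegral_iSup_le hM hX₀ hX₀C hlim fun l => (hθG l).2
  have hces : ∀ᵐ ω ∂P, ∀ l, cesaroMean (fun i => ξ (n (k i))) (ns (θ l)) ω = r * M l ω := by
    have h1 : ∀ᵐ ω ∂P, ∀ m, X m ω = r⁻¹ * ξ m ω :=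
      ae_all_iff.2 fun m => AEEqFun.coeFn_smul r⁻¹ (ξ m)
    have h2 : ∀ᵐ ω ∂P, ∀ l, cesaroMean (fun i => ξ (n (k i))) (ns (θ l)) ω =
        avg (fun i => ⇑(ξ (n (k i)))) (ns (θ l)) ω :=
      ae_all_iff.2 fun l => AEEqFun.coeFn_avg (fun i => ξ (n (k i))) _
    filter_upwards [h1, h2] with ω h1 h2 l
    rw [h2]
    simp only [M, avg_apply]
    simp only [avg, h1, smul_eq_mul]
    rw [← Finset.mul_sum, mul_left_comm, mul_left_comm r, inv_mul_cancel_left₀ hr.ne']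
  have hcesabs : ∀ᵐ ω ∂P, ∀ l, |cesaroMean (fun i => ξ (n (k i))) (ns (θ l))| ω =
      r * |M l ω| := by
    have h1 : ∀ᵐ ω ∂P, ∀ l, |cesaroMean (fun i => ξ (n (k i))) (ns (θ l))| ω =
        |cesaroMean (fun i => ξ (n (k i))) (ns (θ l)) ω| :=
      ae_all_iff.2 fun l => AEEqFun.coeFn_abs _
    filter_upwards [hces, h1] with ω h1 h2 l
    rw [h2, h1, abs_mul, abs_of_pos hr]
  have hmη : Measurable fun ω => r * ⨆ l, |M l ω| :=
    (Measurable.iSup fun l => (hM l).abs).const_mul r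
  have hη := AEEqFun.coeFn_mk (μ := P) _ hmη.aestronglyMeasurable
  refine ⟨ns ∘ θ, hns.comp hθ, fun l => (hθG l).1,
    ⟨AEEqFun.mk _ hmη.aestronglyMeasurable, ⟨r / t, by positivity, ?_⟩, ?_, ?_⟩, ?_⟩
  · refine le_trans (lintegral_mono_ae ?_) htint
    filter_upwards [AEEqFun.coeFn_smul (r / t)⁻¹ (AEEqFun.mk _ hmη.aestronglyMeasurable), hη]
      with ω h1 h2
    rw [h1, Pi.smul_apply, h2, smul_eq_mul, inv_div, ← mul_assoc, div_mul_cancel₀ _ hr.ne']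
  · rintro _ ⟨l, rfl⟩
    refine AEEqFun.coeFn_le.1 ?_
    filter_upwards [hη, hcesabs, hlim] with ω h1 h2 h3
    rw [h1]
    refine (h2 l).trans_le ?_
    gcongr
    exact le_ciSup h3.abs.bddAbove_range l
  · intro ζ hζ
    have hζ' : ∀ᵐ ω ∂P, ∀ l, |cesaroMean (fun i => ξ (n (k i))) (ns (θ l))| ω ≤ ζ ω :=
      ae_all_iff.2 fun l => AEEqFun.coeFn_le.2 (hζ ⟨l, rfl⟩)
    refine AEEqFun.coeFn_le.1 ?_
    filter_upwards [hη, hcesabs, hζ'] with ω h1 h2 h3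
    rw [h1, Real.mul_iSup_of_nonneg hr.le]
    exact ciSup_le fun l => (h2 l).symm.trans_le (h3 l)
  · filter_upwards [hces, hlim, AEEqFun.coeFn_mk _ hm₀.aestronglyMeasurable] with ω h1 h2 h3
    rw [h3]
    exact (h2.const_mul r).congr fun l => (h1 l).symm
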